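/- **Theorem 4.3.** Let $R$ be a commutative ring with unit and let $D$ be an oriented link diagram in the plane with $p$ positive crossings, $n$ negative crossings and writhe $w=p-n$; fix a total order of the crossings. *The extreme Khovanov complex.* A state $s$ assigns a label $A$ or $B$ to each crossing; smoothing the crossings accordingly (the $A$-smoothing merges the two regions swept by the over strand when it is rotated counterclockwise, the $B$-smoothing the other two) gives a collection $sD$ of disjoint circles, together with a chord at each crossing joining the two smoothing arcs there. An enhanced state is a state $s$ together with a sign $\pm1$ for each circle of $sD$. Let $\sigma(s)$ be the number of $A$-labels minus the number of $B$-labels, $\tau(s)$ the sum of the signs, $i(s)=\frac{w-\sigma(s)}2$ and $j(s)=w+i(s)+\tau(s)$. Let $C^{i,j}(D)$ be the free $R$-module on the enhanced states $s$ with $i(s)=i$, $j(s)=j$, and let $d_i\colon C^{i,j}(D)\to C^{i+1,j}(D)$, $d_i(s)=\sum_t (s:t)\,t$. Here $(s:t)=0$ unless $i(t)=i(s)+1$, $j(t)=j(s)$, the labels of $s$ and $t$ agree except at one crossing $x$, where $s$ has an $A$ and $t$ a $B$, and the circles common to $sD$ and $tD$ have the same signs; in that case $(s:t)=(-1)^k$,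 with $k$ the number of $B$-labelled crossings after $x$. Put $H^{i,j}(D)=\ker d_i/\operatorname{im} d_{i-1}$, and let $j_{\min}=j_{\min}(D)$ be the minimum of $j(s)$ over all enhanced states. *The Lando complex.* Let $s_A$ be the state with all labels $A$. The Lando graph $G_D$ has a vertex for each crossing whose chord has both ends on the same circle of $s_AD$, and two different vertices are adjacent if the ends of their chords alternate along the same circle. Let $X_D$ be the independence complex of $G_D$, whose simplices are the independent sets $\rho$ of vertices (including $\emptyset$), with $\dim\rho=|\rho|-1$. Fix any total order of the vertices of $G_D$. Let $C^i(X_D)$ be the free $R$-module on the simplices of dimension $i$, and let $\delta_i\colon C^i(X_D)\to C^{i+1}(X_D)$, $\delta_i(\rho)=\sum_v(-1)^{k}\,(\rho\cup\{v\})$, where $v$ runs over the vertices not in $\rho$ and not adjacent to any vertex of $\rho$, and $k$ is the number of vertices of $\rho$ after $v$. Put $H^i(X_D)=\ker\delta_i/\operatorname{im}\delta_{i-1}$ (reduced cohomology). *Claim.* Both $\{C^{i,j_{\min}}(D),d_i\}$ and $\{C^i(X_D),\delta_i\}$ are cochain complexes ($d_{i+1}d_i=0$ and $\delta_{i+1}\delta_i=0$),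 and the second is a copy of the first shifted by $n-1$: there are $R$-linear isomorphisms $\varphi_i\colon C^{i,j_{\min}}(D)\to C^{i-1+n}(X_D)$, $i\in\mathbb Z$, with $\delta_{i-1+n}\circ\varphi_i=\varphi_{i+1}\circ d_i$ for all $i$. Hence, for all $i\in\mathbb Z$, $$H^{i,j_{\min}}(D)\cong H^{i-1+n}(X_D).$$ -/

import Mathlib

/-!
# Oriented link diagrams, the Khovanov complex, and the independence complex of the Lando graph

A link diagram is encoded by its planar combinatorial map. Around every crossing the four ends of
edges are numbered `0, 1, 2, 3` counterclockwise, `0` being the end through which the strand passing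
*under* arrives (so the under strand runs from `0` to `2`, the over strand joins `1` and `3`).
-/

/-- The cohomology `ker g / (im f ∩ ker g)` of a pair of composable linear maps at the middle term; it
is `ker g / im f` when `g ∘ f = 0`. -/
def MiddleCohomology {R A B C : Type*} [CommRing R] [AddCommGroup A] [AddCommGroup B]
    [AddCommGroup C] [Module R A] [Module R B] [Module R C] (f : A →ₗ[R] B) (g : B →ₗ[R] C) :
    Type _ :=
  LinearMap.ker g ⧸ (LinearMap.range f).submoduleOf (LinearMap.ker g)

section

variable {R A B C : Type*} [CommRing R] [AddCommGroup A] [AddCommGroup B]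
  [AddCommGroup C] [Module R A] [Module R B] [Module R C] (f : A →ₗ[R] B) (g : B →ₗ[R] C)

instance : AddCommGroup (MiddleCohomology f g) :=
  inferInstanceAs
    (AddCommGroup (LinearMap.ker g ⧸ (LinearMap.range f).submoduleOf (LinearMap.ker g)))

instance : Module R (MiddleCohomology f g) :=
  inferInstanceAs
    (Module R (LinearMap.ker g ⧸ (LinearMap.range f).submoduleOf (LinearMap.ker g)))

end

/-- The labels that a state assigns to the crossings. -/
inductive Label
  | A
  | B

noncomputable instance : DecidableEq Label := Classical.decEq _

instance : Finite Label :=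
  Finite.of_injective (fun l : Label => match l with | .A => true | .B => false) (by
    rintro ⟨⟩ ⟨⟩ h <;> simp_all)

/-- The combinatorial data underlying an oriented link diagram: finitely many crossings with their
signs, the way in which the edges join the ends `(x, k)` at the crossings, and the number of
components that meet no crossing (these are disjoint simple closed curves). -/
structure DiagramData where
  /-- the crossings -/
  Crossing : Type
  /-- there are finitely many crossings -/
  finiteCrossing : Fintype Crossing
  /-- the end opposite to a given end on the same edge -/
  edge : Crossing × ZMod 4 → Crossing × ZMod 4
  edge_involutive : Function.Involutive edge
  /-- the sign of a crossing -/
  sign : Crossing → ℤˣ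
  /-- the number of components without crossings -/
  freeCircles : ℕ

namespace DiagramData

variable (D : DiagramData)

instance : Fintype D.Crossing := D.finiteCrossing

/-- The ends of edges at the crossings; `(x, k)` is the `k`-th end at `x`, counterclockwise. -/
abbrev End : Type := D.Crossing × ZMod 4

/-- The orientation points away from the crossing at this end. The under strand leaves at `2`.
At a positive crossing the over strand runs from `3` to `1`, at a negative one from `1` to `3`. -/
def IsOut (d : D.End) : Prop :=
  d.2 = 2 ∨ (D.sign d.1 = 1 ∧ d.2 = 1) ∨ (D.sign d.1 = -1 ∧ d.2 = 3)

/-- Every edge is oriented from one of its ends to the other. In particular, `edge` has no fixed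
points. -/
def IsOriented : Prop := ∀ d : D.End, D.IsOut (D.edge d) ↔ ¬ D.IsOut d

/-- The connected components of the underlying 4-valent graph. -/
abbrev Component : Type :=
  Quot (fun x y : D.Crossing => ∃ k l : ZMod 4, D.edge (x, k) = (y, l))

/-- The faces of the underlying combinatorial map: the orbits of
"follow the edge, then turn to the next end at the crossing reached". -/
abbrev Face : Type :=
  Quot (fun d d' : D.End => d' = ((D.edge d).1, (D.edge d).2 + 1))

/-- Every connected component of the underlying graph is embedded in a sphere: with `c` vertices and
`2 c` edges, Euler's formula summed over the components reads `c - 2 c + #faces = 2 #components`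
(a component of genus `g` contributes `2 - 2 g`, so equality forces genus `0` everywhere). -/
def IsPlanar : Prop :=
  (Fintype.card D.Crossing : ℤ) - 2 * Fintype.card D.Crossing + Nat.card D.Face
    = 2 * Nat.card D.Component

end DiagramData

/-- An oriented link diagram in the plane. -/
structure LinkDiagram extends DiagramData where
  oriented : toDiagramData.IsOriented
  planar : toDiagramData.IsPlanar

namespace LinkDiagram

variable (D : LinkDiagram)

open Classical in
/-- The number of positive crossings. -/
noncomputable def numPos : ℕ := (Finset.univ.filter fun x : D.Crossing => D.sign x = 1).card

open Classical in
/-- The number of negative crossings. -/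
noncomputable def numNeg : ℕ := (Finset.univ.filter fun x : D.Crossing => D.sign x = -1).card

/-- The writhe. -/
noncomputable def writhe : ℤ := (D.numPos : ℤ) - D.numNeg

/-- A state assigns a label to each crossing. -/
abbrev State : Type := D.Crossing → Label

/-- The smoothing of a crossing according to its label. The `A`-smoothing merges the two regions
swept by the over strand when it is turned counterclockwise, so its two arcs join the ends
`0, 1` and `2, 3`; the arcs of the `B`-smoothing join `1, 2` and `3, 0`. -/
def smooth (s : D.State) (d : D.End) : D.End :=
  match s d.1 with
  | .A => (d.1, 1 - d.2)
  | .B => (d.1, 3 - d.2)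

/-- The circles of the smoothed diagram `sD` that meet some crossing, as classes of ends. -/
abbrev CrossingCircle (s : D.State) : Type :=
  Quot (fun d d' : D.End => d' = D.edge d ∨ d' = D.smooth s d)

/-- The circles of the smoothed diagram `sD`. -/
abbrev Circle (s : D.State) : Type := D.CrossingCircle s ⊕ Fin D.freeCircles

noncomputable instance (s : D.State) : Fintype (D.Circle s) := Fintype.ofFinite _

/-- The circle of `sD` through a given end. -/
def circleAt (s : D.State) (d : D.End) : D.Circle s := Sum.inl (Quot.mk _ d)

/-- An enhanced state: a state `s` together with a sign for each circle of `sD`. -/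
structure EnhancedState where
  /-- the labels of the crossings -/
  label : D.State
  /-- the signs of the circles -/
  sgn : D.Circle label → ℤˣ

instance : Finite D.EnhancedState :=
  Finite.of_injective
    (fun s : D.EnhancedState => (⟨s.label, s.sgn⟩ : Σ l : D.State, (D.Circle l → ℤˣ)))
    (by rintro ⟨a, b⟩ ⟨a', b'⟩ h; cases h; rfl)

instance : Nonempty D.EnhancedState := ⟨⟨fun _ => .A, fun _ => 1⟩⟩

namespace EnhancedState

variable {D}

/-- The number of `A`-labels. -/
noncomputable def a (s : D.EnhancedState) : ℕ :=
  (Finset.univ.filter fun x : D.Crossing => s.label x = .A).card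

/-- The number of `B`-labels. -/
noncomputable def b (s : D.EnhancedState) : ℕ :=
  (Finset.univ.filter fun x : D.Crossing => s.label x = .B).card

/-- `σ(s) = a(s) - b(s)`. -/
noncomputable def sigma (s : D.EnhancedState) : ℤ := (s.a : ℤ) - s.b

/-- `τ(s)`, the sum of the signs of the circles. -/
noncomputable def tau (s : D.EnhancedState) : ℤ := ∑ C, ((s.sgn C : ℤˣ) : ℤ)

/-- `i(s) = (w - σ(s)) / 2`; the division is exact, see `two_mul_degI`. -/
noncomputable def degI (s : D.EnhancedState) : ℤ := (D.writhe - s.sigma) / 2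

/-- `j(s) = w + i(s) + τ(s)`. -/
noncomputable def degJ (s : D.EnhancedState) : ℤ := D.writhe + s.degI + s.tau

theorem two_mul_degI (s : D.EnhancedState) : 2 * s.degI = D.writhe - s.sigma := by
  classical
  have h1 : D.numPos + D.numNeg = Fintype.card D.Crossing := by
    have h : ∀ x : D.Crossing, D.sign x = -1 ↔ ¬ D.sign x = 1 := by
      intro x
      rcases Int.units_eq_one_or (D.sign x) with h | h <;> rw [h] <;> decide
    unfold numPos numNeg
    simp only [h]
    rw [Finset.card_filter_add_card_filter_not]
    rfl
  have h2 : s.a + s.b = Fintype.card D.Crossing := by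
    have h : ∀ x : D.Crossing, s.label x = .B ↔ ¬ s.label x = .A := by
      intro x
      cases s.label x <;> simp
    unfold a b
    simp only [h]
    rw [Finset.card_filter_add_card_filter_not]
    rfl
  unfold degI writhe sigma
  omega

/-- `t` is adjacent to `s` with change crossing `x`: the bidegrees are `(i + 1, j)` and `(i, j)`,
the labels agree except at `x`, where `s` has an `A` and `t` a `B`, and the circles that are common
to `sD` and `tD` (those which do not touch `x`) have the same sign in both. -/
structure AdjacentAt (s t : D.EnhancedState) (x : D.Crossing) : Prop where
  degI_eq : t.degI = s.degI + 1
  degJ_eq : t.degJ = s.degJ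
  label_left : s.label x = .A
  label_right : t.label x = .B
  label_eq : ∀ y, y ≠ x → t.label y = s.label y
  sgn_eq : ∀ d : D.End, (∀ k : ZMod 4, D.circleAt s.label (x, k) ≠ D.circleAt s.label d) →
    t.sgn (D.circleAt t.label d) = s.sgn (D.circleAt s.label d)
  sgn_free : ∀ m : Fin D.freeCircles, t.sgn (Sum.inr m) = s.sgn (Sum.inr m)

open Classical in
/-- The incidence number `(s : t)` with respect to the order `o` of the crossings: it is `0` if `t`
is not adjacent to `s`; otherwise it is `(-1) ^ k`, where `k` is the number of `B`-labelled crossings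
after the change crossing `x`. (The sum over `x` has at most one nonzero term.) -/
noncomputable def incidence (R : Type*) [CommRing R] (o : LinearOrder D.Crossing)
    (s t : D.EnhancedState) : R :=
  ∑ x, if s.AdjacentAt t x then
    (-1) ^ (Finset.univ.filter fun y : D.Crossing => s.label y = .B ∧ o.lt x y).card else 0

end EnhancedState

/-- The enhanced states `s` with `i(s) = i` and `j(s) = j`. -/
abbrev Generator (i j : ℤ) : Type := {s : D.EnhancedState // s.degI = i ∧ s.degJ = j}

noncomputable instance (i j : ℤ) : Fintype (D.Generator i j) := Fintype.ofFinite _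

/-- The free module `C^{i,j}(D)`. -/
abbrev khovanovModule (R : Type*) [CommRing R] (i j : ℤ) : Type _ := D.Generator i j →₀ R

/-- The component `C^{i,j}(D) → C^{i',j}(D)`, `s ↦ ∑ (s : t) t`, of the Khovanov differential. It is
`d_i` for `i' = i + 1`, and zero for other `i'`. -/
noncomputable def khovanovD (R : Type*) [CommRing R] (o : LinearOrder D.Crossing) (j i i' : ℤ) :
    D.khovanovModule R i j →ₗ[R] D.khovanovModule R i' j :=
  Finsupp.linearCombination R fun s : D.Generator i j =>
    ∑ t : D.Generator i' j, Finsupp.single t (s.1.incidence R o t.1)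

/-- The Khovanov cohomology `H^{i,j}(D) = ker d_i / im d_{i-1}`. -/
abbrev khovanovCohomology (R : Type*) [CommRing R] (o : LinearOrder D.Crossing) (i j : ℤ) : Type _ :=
  MiddleCohomology (D.khovanovD R o j (i - 1) i) (D.khovanovD R o j i (i + 1))

/-- `j_min(D)`, the minimum of `j(s)` over all enhanced states. -/
noncomputable def jMin : ℤ := sInf (Set.range fun s : D.EnhancedState => s.degJ)

theorem isLeast_jMin : IsLeast (Set.range fun s : D.EnhancedState => s.degJ) D.jMin :=
  have hb : BddBelow (Set.range fun s : D.EnhancedState => s.degJ) := (Set.finite_range _).bddBelow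
  ⟨Int.csInf_mem (Set.range_nonempty _) hb, fun _ hx => csInf_le hb hx⟩

/-- The state `s_A`, which assigns an `A` to every crossing. -/
def stateA : D.State := fun _ => .A

/-- The `A`-chord at `x` joins, in `s_A D`, the smoothing arc through the ends `0, 1` with the one
through the ends `2, 3`. It is admissible if both arcs belong to the same circle. -/
def IsAdmissible (x : D.Crossing) : Prop :=
  D.circleAt D.stateA (x, 0) = D.circleAt D.stateA (x, 2)

/-- Travelling along a circle of `s_A D`: arriving at a crossing through the end `d`, take the
smoothing arc there and then the next edge, up to the crossing where it ends. The orbit of `d` runs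
once around the circle and passes through each of its smoothing arcs exactly once. -/
def travel (d : D.End) : D.End := D.edge (D.smooth D.stateA d)

/-- The ends of the `A`-chords at `x` and `y` alternate along a circle of `s_A D`: some single turn
around the circle meets chord ends at `x`, `y`, `x`, `y` in this order. -/
def Alternate (x y : D.Crossing) : Prop :=
  ∃ d : D.End, ∃ k l m : ℕ, 0 < k ∧ k < l ∧ l < m ∧ m < Function.minimalPeriod D.travel d ∧
    d.1 = x ∧ (D.travel^[k] d).1 = y ∧ (D.travel^[l] d).1 = x ∧ (D.travel^[m] d).1 = y

theorem Alternate.symm {x y : D.Crossing} (h : D.Alternate x y) : D.Alternate y x := by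
  obtain ⟨d, k, l, m, hk, hkl, hlm, hm, h0, h1, h2, h3⟩ := h
  have hp : d ∈ Function.periodicPts D.travel :=
    Function.minimalPeriod_pos_iff_mem_periodicPts.1 (by omega)
  have hn := Function.minimalPeriod_apply_iterate hp k
  refine ⟨D.travel^[k] d, l - k, m - k, Function.minimalPeriod D.travel d - k,
    by omega, by omega, by omega, by omega, h1, ?_, ?_, ?_⟩
  · rw [← Function.iterate_add_apply, Nat.sub_add_cancel (by omega)]; exact h2
  · rw [← Function.iterate_add_apply, Nat.sub_add_cancel (by omega)]; exact h3
  · rw [← Function.iterate_add_apply, Nat.sub_add_cancel (by omega),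
      Function.iterate_minimalPeriod]; exact h0

/-- The vertices of the Lando graph: the admissible `A`-chords. -/
abbrev LandoVertex : Type := {x : D.Crossing // D.IsAdmissible x}

noncomputable instance : Fintype D.LandoVertex := Fintype.ofFinite _

/-- The Lando graph `G_D`: two admissible `A`-chords are adjacent if their ends alternate in the same
circle of `s_A D`. -/
def landoGraph : SimpleGraph D.LandoVertex where
  Adj v w := v ≠ w ∧ D.Alternate v.1 w.1
  symm := ⟨fun _ _ h => ⟨h.1.symm, h.2.symm⟩⟩
  loopless := ⟨fun _ h => h.1 rfl⟩

end LinkDiagram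

namespace IndependenceComplex

variable {V : Type*} [Fintype V] (G : SimpleGraph V)

/-- The simplices of dimension `i` of the independence complex of `G`: the independent sets of
`i + 1` vertices. The empty set is the simplex of dimension `-1`. -/
abbrev Simplex (i : ℤ) : Type _ :=
  {σ : Finset V // G.IsIndepSet (σ : Set V) ∧ (σ.card : ℤ) - 1 = i}

noncomputable instance (i : ℤ) : Fintype (Simplex G i) := Fintype.ofFinite _

/-- The free module generated by the simplices of dimension `i`. -/
abbrev cochain (R : Type*) [CommRing R] (i : ℤ) : Type _ := Simplex G i →₀ R

open Classical in
/-- The coefficient of `ρ` in the coboundary of `σ`, with respect to the order `o` of the vertices: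
`(-1) ^ k` if `ρ = σ ∪ {v}` with `v ∉ σ`, where `k` is the number of vertices of `σ` after `v`, and
`0` if there is no such `v`. (The sum over `v` has at most one nonzero term.) -/
noncomputable def coefficient (R : Type*) [CommRing R] (o : LinearOrder V) (σ ρ : Finset V) : R :=
  ∑ v, if v ∉ σ ∧ ρ = insert v σ then (-1) ^ (σ.filter fun u => o.lt v u).card else 0

/-- The component from degree `i` to degree `i'` of the coboundary. It is `δ_i` for `i' = i + 1`, and
zero for other `i'`. -/
noncomputable def coboundary (R : Type*) [CommRing R] (o : LinearOrder V) (i i' : ℤ) :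
    cochain G R i →ₗ[R] cochain G R i' :=
  Finsupp.linearCombination R fun σ : Simplex G i =>
    ∑ ρ : Simplex G i', Finsupp.single ρ (coefficient R o σ.1 ρ.1)

/-- The reduced cohomology `ker δ_i / im δ_{i-1}` of the independence complex of `G`. -/
abbrev cohomology (R : Type*) [CommRing R] (o : LinearOrder V) (i : ℤ) : Type _ :=
  MiddleCohomology (coboundary G R o (i - 1) i) (coboundary G R o i (i + 1))

end IndependenceComplex

/-! A state whose `B`-labels form the set `B` has `i = |B| - n`, and its `τ` is at least minus the
number of its circles. Switching one label from `A` to `B` adds at most one circle, so `j ≥ w - n -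
|s_A D|`. The all-`A` state with negative signs attains this bound, which is therefore `j_min`. The
extreme states are those with only negative signs in which each `B`-label gains a circle. By
`degJ_eq_jMin_iff` this means that the `B`-chords are admissible and pairwise non-alternating: they
form a simplex of `X_D`, of dimension `|B| - 1 = i - 1 + n`. Both differentials then add one chord
at a time, and their signs differ only through the chosen orders, which `reorderSign` corrects
(`reorderSign_mul_coefficient`).

Circles are counted with permutations. Planarity makes the first homology mod 2 vanish, which yields
a checkerboard colouring. It orients the circles of all states at once: they arrive at crossings
through black ends. Circles thus become cycles of a permutation `flow` of the black ends, and
switching a label at `x` multiplies it by the transposition of the two black ends at `x`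
(`flow_insert`). A transposition splits a cycle if its points share one, and merges two cycles
otherwise. Alternation of two chords of a cycle means that cutting along one separates the ends of
the other (`exists_alternating_of_not_sameCycle`, `not_sameCycle_of_alternating`). -/

namespace Equiv.Perm

/-! ### Cycles of a permutation composed with a transposition -/

variable {α : Type*} [Fintype α] [DecidableEq α] {p : Perm α} {a b : α}

omit [DecidableEq α] in
-- On a finite set nonnegative powers exhaust a cycle, so forward closure suffices. This is the
-- induction principle used for cycles below.
theorem SameCycle.mem_of_closed {S : Set α} (hS : ∀ z ∈ S, p z ∈ S) {x y : α}
    (h : SameCycle p x y) (hx : x ∈ S) : y ∈ S := by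
  obtain ⟨n, -, rfl⟩ := h.exists_pow_eq'
  clear h
  induction n with
  | zero => simpa
  | succ n ih => rw [pow_succ', mul_apply]; exact hS _ ih

omit [Fintype α] in
theorem mul_swap_apply_of_ne {z : α} (ha : z ≠ a) (hb : z ≠ b) : (p * swap a b) z = p z := by
  rw [mul_apply, swap_apply_of_ne_of_ne ha hb]

theorem SameCycle.of_mul_swap (hab : SameCycle p a b) {x y : α}
    (h : SameCycle (p * swap a b) x y) : SameCycle p x y := by
  refine h.mem_of_closed (S := {z | SameCycle p x z}) (fun z hz => ?_) (SameCycle.refl _ _)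
  simp only [Set.mem_ofPred_eq] at hz ⊢
  by_cases h1 : z = a
  · subst h1
    simpa using hz.trans hab
  by_cases h2 : z = b
  · subst h2
    simpa using hz.trans hab.symm
  rw [mul_swap_apply_of_ne h1 h2]
  simpa using hz

theorem SameCycle.mul_swap_or {x : α} (h : SameCycle p a x) :
    SameCycle (p * swap a b) a x ∨ SameCycle (p * swap a b) b x := by
  refine h.mem_of_closed
    (S := {z | SameCycle (p * swap a b) a z ∨ SameCycle (p * swap a b) b z})
    (fun z hz => ?_) (Or.inl (SameCycle.refl _ _))
  simp only [Set.mem_ofPred_eq] at hz ⊢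
  by_cases h1 : z = a
  · subst h1
    right
    have : p z = (p * swap z b) b := by simp
    rw [this, sameCycle_apply_right]
  by_cases h2 : z = b
  · subst h2
    left
    have : p z = (p * swap a z) a := by simp
    rw [this, sameCycle_apply_right]
  rw [← mul_swap_apply_of_ne (p := p) h1 h2, sameCycle_apply_right, sameCycle_apply_right]
  exact hz

/-- The composite sends `a` to `p b` and then follows `p` around the cycle of `b`, which avoids `a`,
until it reaches `b`. -/
theorem sameCycle_mul_swap_of_not_sameCycle (h : ¬ SameCycle p a b) :
    SameCycle (p * swap a b) a b := by
  by_contra h'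
  have hpb : SameCycle p (p b) b := sameCycle_apply_left.2 (SameCycle.refl _ _)
  refine h' ((hpb.mem_of_closed
    (S := {z | SameCycle (p * swap a b) a z ∧ SameCycle p b z}) ?_ ?_).1)
  · rintro z ⟨hz1, hz2⟩
    have h1 : z ≠ a := by rintro rfl; exact h hz2.symm
    have h2 : z ≠ b := by rintro rfl; exact h' hz1
    refine ⟨?_, by simpa using hz2⟩
    rw [← mul_swap_apply_of_ne (p := p) h1 h2, sameCycle_apply_right]
    exact hz1
  · refine ⟨?_, sameCycle_apply_right.2 (SameCycle.refl _ _)⟩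
    have : p b = (p * swap a b) a := by simp
    rw [this, sameCycle_apply_right]

/-- If `a` and `b` lie on the same cycle, then the cycle of `b` after composing with `swap a b` is the
arc that leads from `a` to `b`. -/
theorem SameCycle.exists_arc (hab : SameCycle p a b) (hne : a ≠ b) :
    ∃ n : ℕ, 0 < n ∧ (p ^ n) a = b ∧ (∀ j, 0 < j → j ≤ n → (p ^ j) a ≠ a) ∧
      ∀ z, SameCycle (p * swap a b) b z ↔ ∃ j, 0 < j ∧ j ≤ n ∧ (p ^ j) a = z := by
  classical
  have hex : ∃ n : ℕ, (p ^ n) a = b := by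
    obtain ⟨n, -, h⟩ := hab.exists_pow_eq'
    exact ⟨n, h⟩
  obtain ⟨n, hn, hmin⟩ : ∃ n : ℕ, (p ^ n) a = b ∧ ∀ m < n, (p ^ m) a ≠ b :=
    ⟨Nat.find hex, Nat.find_spec hex, fun m hm => Nat.find_min hex hm⟩
  have hn0 : 0 < n := by
    rcases Nat.eq_zero_or_pos n with rfl | h
    · exact absurd (by simpa using hn) hne
    · exact h
  -- A return to `a` at time `j ≤ n` would allow `b` to be reached already at time `n - j`.
  have hna : ∀ j, 0 < j → j ≤ n → (p ^ j) a ≠ a := by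
    intro j hj hjn hja
    refine hmin (n - j) (by omega) ?_
    rw [← hn]
    conv_rhs => rw [← Nat.sub_add_cancel hjn, pow_add, mul_apply, hja]
  refine ⟨n, hn0, hn, hna, fun z => ⟨fun h => ?_, ?_⟩⟩
  · refine h.mem_of_closed (S := {z | ∃ j, 0 < j ∧ j ≤ n ∧ (p ^ j) a = z}) ?_ ⟨n, hn0, le_rfl, hn⟩
    rintro _ ⟨j, hj, hjn, rfl⟩
    rcases hjn.lt_or_eq with hlt | rfl
    · refine ⟨j + 1, by omega, hlt, ?_⟩
      rw [mul_swap_apply_of_ne (hna j hj hjn) (hmin j hlt), pow_succ', mul_apply]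
    -- The composite sends `b` to `p a`, which closes the arc.
    · exact ⟨1, one_pos, hj, by rw [hn]; simp⟩
  · rintro ⟨j, hj, hjn, rfl⟩
    induction j with
    | zero => omega
    | succ j ih =>
      rcases Nat.eq_zero_or_pos j with rfl | hj0
      · have : (p ^ (0 + 1)) a = (p * swap a b) b := by simp
        rw [this, sameCycle_apply_right]
      · have := ih hj0 (by omega)
        rw [← sameCycle_apply_right, mul_swap_apply_of_ne (hna j hj0 (by omega))
          (hmin j (by omega))] at this
        rwa [pow_succ', mul_apply]

theorem SameCycle.not_sameCycle_mul_swap (hab : SameCycle p a b) (hne : a ≠ b) :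
    ¬ SameCycle (p * swap a b) a b := by
  obtain ⟨n, -, -, hna, h⟩ := hab.exists_arc hne
  intro h'
  obtain ⟨j, hj, hjn, hja⟩ := (h a).1 h'.symm
  exact hna j hj hjn hja

/-- The number of cycles of a permutation, fixed points included. -/
noncomputable def numCycles (p : Perm α) : ℕ := Nat.card (Quotient (SameCycle.setoid p))

/-- Only the cycles of `a` and `b` change, and they merge. Hence the cycles of `p` other than that
of `b` correspond bijectively to the cycles of the composite. -/
theorem numCycles_of_not_sameCycle (h : ¬ SameCycle p a b) :
    numCycles p = numCycles (p * swap a b) + 1 := by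
  classical
  set q := p * swap a b with hq
  have hqab : SameCycle q a b := sameCycle_mul_swap_of_not_sameCycle h
  have hqp : q * swap a b = p := by simp [hq, mul_assoc]
  have hpq : ∀ {x y}, SameCycle p x y → SameCycle q x y := fun {x y} hxy =>
    SameCycle.of_mul_swap hqab (hqp ▸ hxy)
  let f : {c : Quotient (SameCycle.setoid p) // c ≠ Quotient.mk _ b} →
      Quotient (SameCycle.setoid q) :=
    fun c => Quotient.map' (s₁ := SameCycle.setoid p) (s₂ := SameCycle.setoid q) id
      (fun _ _ hxy => hpq hxy) c.1
  have key : ∀ x, ∃ y, SameCycle q x y ∧ ¬ SameCycle p y b := by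
    intro x
    by_cases hx : SameCycle p x b
    · exact ⟨a, (hpq hx).trans hqab.symm, h⟩
    · exact ⟨x, SameCycle.refl _ _, hx⟩
  have hf : Function.Bijective f := by
    constructor
    · rintro ⟨c, hc⟩ ⟨d, hd⟩ hcd
      induction c using Quotient.inductionOn with | _ x
      induction d using Quotient.inductionOn with | _ y
      have hxy : SameCycle q x y := Quotient.exact hcd
      have hx : ¬ SameCycle p x b := fun h => hc (Quotient.sound h)
      have hy : ¬ SameCycle p y b := fun h => hd (Quotient.sound h)
      refine Subtype.ext (Quotient.sound (?_ : SameCycle p x y))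
      -- A cycle of `p` through neither `a` nor `b` is left unchanged.
      have hcl : ∀ {x y}, SameCycle q x y → ¬ SameCycle p x b → ¬ SameCycle p x a →
          SameCycle p x y := by
        intro x y hxy hx hxa
        refine hxy.mem_of_closed (S := {z | SameCycle p x z}) (fun z hz => ?_)
          (SameCycle.refl _ _)
        have h1 : z ≠ a := by rintro rfl; exact hxa hz
        have h2 : z ≠ b := by rintro rfl; exact hx hz
        rw [hq, mul_swap_apply_of_ne h1 h2]
        exact (sameCycle_apply_right).2 hz
      by_cases hxa : SameCycle p x a
      · by_cases hya : SameCycle p y a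
        · exact hxa.trans hya.symm
        · exact (hcl hxy.symm hy hya).symm
      · exact hcl hxy hx hxa
    · intro c
      induction c using Quotient.inductionOn with | _ x
      obtain ⟨y, hxy, hy⟩ := key x
      exact ⟨⟨Quotient.mk _ y, fun h => hy (Quotient.exact h)⟩, Quotient.sound hxy.symm⟩
  have := Nat.card_congr (Equiv.ofBijective f hf)
  rw [numCycles, numCycles, ← this]
  have h2 := Nat.card_congr (Equiv.optionSubtypeNe (Quotient.mk (SameCycle.setoid p) b))
  rw [← h2, Finite.card_option]

theorem SameCycle.numCycles_mul_swap (h : SameCycle p a b) (hne : a ≠ b) :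
    numCycles (p * swap a b) = numCycles p + 1 := by
  rw [numCycles_of_not_sameCycle (h.not_sameCycle_mul_swap hne), mul_assoc, swap_mul_self, mul_one]

theorem numCycles_mul_swap_le (hne : a ≠ b) :
    numCycles (p * swap a b) ≤ numCycles p + 1 := by
  by_cases h : SameCycle p a b
  · exact (h.numCycles_mul_swap hne).le
  · have := numCycles_of_not_sameCycle h
    omega

theorem sameCycle_of_numCycles_lt (h : numCycles p < numCycles (p * swap a b)) :
    SameCycle p a b := by
  by_contra h'
  have := numCycles_of_not_sameCycle h'
  omega

/-- Two chords of a cycle, `a b` and `c d`, alternate if `a b` separates `c` from `d`. -/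
theorem exists_alternating_of_not_sameCycle {c d : α} (hne : a ≠ b) (hab : SameCycle p a b)
    (hcd : SameCycle p c d) (hq : ¬ SameCycle (p * swap a b) c d) (hca : c ≠ a) (hcb : c ≠ b)
    (hda : d ≠ a) (hdb : d ≠ b) :
    ∃ k l m : ℕ, 0 < k ∧ k < l ∧ l < m ∧ m < Function.minimalPeriod p a ∧
      (p ^ l) a = b ∧ ((p ^ k) a = c ∧ (p ^ m) a = d ∨ (p ^ k) a = d ∧ (p ^ m) a = c) := by
  -- Otherwise the common cycle of `c` and `d` avoids `a` and `b`, and the transposition cannot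
  -- separate them.
  have hac : SameCycle p a c := by
    by_contra h
    refine hq (hcd.mem_of_closed (S := {z | SameCycle (p * swap a b) c z ∧ SameCycle p c z})
      ?_ ⟨SameCycle.refl _ _, SameCycle.refl _ _⟩).1
    rintro z ⟨hz, hz'⟩
    have h1 : z ≠ a := by rintro rfl; exact h hz'.symm
    have h2 : z ≠ b := by rintro rfl; exact h (hab.trans hz'.symm)
    refine ⟨?_, by simpa using hz'⟩
    rw [← mul_swap_apply_of_ne (p := p) h1 h2, sameCycle_apply_right]
    exact hz
  -- The piece of `b` is the arc from `a` to `b`: the point on it comes before `b`, the other point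
  -- after `b`.
  have hsep : ∀ {c d : α}, SameCycle p a c → c ≠ a → d ≠ b → SameCycle (p * swap a b) b d →
      ¬ SameCycle (p * swap a b) b c →
      ∃ k l m : ℕ, 0 < k ∧ k < l ∧ l < m ∧ m < Function.minimalPeriod p a ∧
      (p ^ l) a = b ∧ (p ^ k) a = d ∧ (p ^ m) a = c := by
    intro c d hac hca hdb hbd hbc
    obtain ⟨n, hn0, hn, -, harc⟩ := hab.exists_arc hne
    obtain ⟨k, hk0, hkn, hk⟩ := (harc d).1 hbd
    obtain ⟨m, -, hm⟩ := hac.exists_pow_eq'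
    have hper : 0 < Function.minimalPeriod p a :=
      Function.minimalPeriod_pos_of_mem_periodicPts (p.injective.mem_periodicPts a)
    have hm' : (p ^ (m % Function.minimalPeriod p a)) a = c := by
      rw [← hm, ← iterate_eq_pow, ← iterate_eq_pow, Function.iterate_mod_minimalPeriod_eq]
    refine ⟨k, n, m % Function.minimalPeriod p a, hk0, ?_, ?_, Nat.mod_lt _ hper, hn, hk, hm'⟩
    · refine lt_of_le_of_ne hkn ?_
      rintro rfl
      exact hdb (hk.symm.trans hn)
    · by_contra hle
      refine hbc ((harc c).2 ⟨_, ?_, not_lt.1 hle, hm'⟩)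
      rw [Nat.pos_iff_ne_zero]
      intro h0
      rw [h0] at hm'
      exact hca (by simpa using hm'.symm)
  have had := hac.trans hcd
  rcases hac.mul_swap_or (b := b) with h1 | h1 <;> rcases had.mul_swap_or (b := b) with h2 | h2
  · exact absurd (h1.symm.trans h2) hq
  · obtain ⟨k, l, m, h⟩ := hsep hac hca hdb h2 (fun h => hq (h.symm.trans h2))
    exact ⟨k, l, m, h.1, h.2.1, h.2.2.1, h.2.2.2.1, h.2.2.2.2.1, Or.inr h.2.2.2.2.2⟩
  · obtain ⟨k, l, m, h⟩ := hsep had hda hcb h1 (fun h => hq (h1.symm.trans h))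
    exact ⟨k, l, m, h.1, h.2.1, h.2.2.1, h.2.2.2.1, h.2.2.2.2.1, Or.inl h.2.2.2.2.2⟩
  · exact absurd (h1.symm.trans h2) hq

/-- After the cut, the points at times `k + 1, ..., m` form a closed set, which contains the point
at time `l` but not `u` itself. -/
theorem not_sameCycle_of_alternating {u : α} {k l m : ℕ} (hk : 0 < k) (hkl : k < l) (hlm : l < m)
    (hm : m < Function.minimalPeriod p u) :
    ¬ SameCycle (p * swap ((p ^ k) u) ((p ^ m) u)) u ((p ^ l) u) := by
  have hinj : ∀ i j, i ≤ m → j ≤ m → (p ^ i) u = (p ^ j) u → i = j := by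
    intro i j hi hj hij
    rw [← iterate_eq_pow, ← iterate_eq_pow] at hij
    exact Function.iterate_injOn_Iio_minimalPeriod (Set.mem_Iio.2 (by omega))
      (Set.mem_Iio.2 (by omega)) hij
  intro h
  obtain ⟨j, hj, hjm, hju⟩ := h.symm.mem_of_closed (S := {z | ∃ j, k < j ∧ j ≤ m ∧ (p ^ j) u = z})
    (by
      rintro _ ⟨j, hj, hjm, rfl⟩
      rcases hjm.lt_or_eq with hlt | rfl
      · refine ⟨j + 1, by omega, hlt, ?_⟩
        rw [mul_swap_apply_of_ne, pow_succ', mul_apply]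
        · intro h; have := hinj _ _ hjm (by omega) h; omega
        · intro h; have := hinj _ _ hjm le_rfl h; omega
      -- From time `m` the transposition jumps back to time `k`, so the next point is that of time
      -- `k + 1`.
      · exact ⟨k + 1, by omega, by omega, by rw [mul_apply, swap_apply_right, pow_succ', mul_apply]⟩)
    ⟨l, hkl, hlm.le, rfl⟩
  have := hinj j 0 hjm (by omega) (by simpa using hju)
  omega

end Equiv.Perm

/-! ### The coboundary of the independence complex and the change of vertex order -/

namespace IndependenceComplex

variable {V : Type*} [Fintype V]

open Classical in
theorem coefficient_insert (R : Type*) [CommRing R] (o : LinearOrder V)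
    {σ : Finset V} {v : V} (hv : v ∉ σ) :
    coefficient R o σ (insert v σ) = (-1) ^ (σ.filter fun u => o.lt v u).card := by
  classical
  unfold coefficient
  rw [Finset.sum_eq_single v]
  · rw [if_pos ⟨hv, rfl⟩]
  · rintro w - hw
    rw [if_neg]
    rintro ⟨h1, h2⟩
    have : w ∈ insert v σ := by rw [h2]; simp
    simp [hw, h1] at this
  · simp

theorem coefficient_of_mem_iff (R : Type*) [CommRing R] (o : LinearOrder V)
    {σ ρ : Finset V} {v : V} (hv : v ∉ σ) (hρ : ∀ u, u ∈ ρ ↔ u = v ∨ u ∈ σ) :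
    coefficient R o σ ρ = (-1) ^ (σ.filter fun u => o.lt v u).card := by
  classical
  rw [← coefficient_insert R o hv]
  congr 1
  ext u
  rw [hρ, Finset.mem_insert]

open Classical in
theorem exists_of_coefficient_ne_zero {R : Type*} [CommRing R]
    {o : LinearOrder V} {σ ρ : Finset V} (h : coefficient R o σ ρ ≠ 0) :
    ∃ v, v ∉ σ ∧ ρ = insert v σ := by
  classical
  by_contra! h'
  refine h (Finset.sum_eq_zero fun v _ => if_neg ?_)
  rintro ⟨h1, h2⟩
  refine h' v h1 (h2.trans ?_)
  ext; simp

theorem exists_mem_iff_of_coefficient_ne_zero {R : Type*} [CommRing R]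
    {o : LinearOrder V} {σ ρ : Finset V} (h : coefficient R o σ ρ ≠ 0) :
    ∃ v, v ∉ σ ∧ ∀ u, u ∈ ρ ↔ u = v ∨ u ∈ σ := by
  obtain ⟨v, hv, hρ⟩ := exists_of_coefficient_ne_zero h
  exact ⟨v, hv, fun u => by rw [hρ, Finset.mem_insert]⟩

theorem coboundary_single_apply (G : SimpleGraph V) (R : Type*) [CommRing R] (o : LinearOrder V)
    {i i' : ℤ} (σ : Simplex G i) (r : R) (ρ : Simplex G i') :
    coboundary G R o i i' (Finsupp.single σ r) ρ = r * coefficient R o σ.1 ρ.1 := by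
  classical
  rw [coboundary, Finsupp.linearCombination_single, Finsupp.smul_apply, Finsupp.finsetSum_apply,
    Finset.sum_eq_single ρ]
  · rw [Finsupp.single_eq_same, smul_eq_mul]
  · intro τ _ h
    rw [Finsupp.single_eq_of_ne h.symm]
  · simp

theorem coboundary_apply (G : SimpleGraph V) (R : Type*) [CommRing R] (o : LinearOrder V)
    {i i' : ℤ} (f : cochain G R i) (ρ : Simplex G i') :
    coboundary G R o i i' f ρ = ∑ σ, f σ * coefficient R o σ.1 ρ.1 := by
  classical
  induction f using Finsupp.induction_linear with
  | zero => simp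
  | add f g hf hg => simp [hf, hg, add_mul, Finset.sum_add_distrib]
  | single σ r =>
    rw [coboundary_single_apply, Finset.sum_eq_single σ]
    · simp
    · intro τ _ h
      rw [Finsupp.single_eq_of_ne h, zero_mul]
    · simp

open Classical in
/-- Adding two vertices in either order produces opposite signs. -/
theorem coefficient_mul_add_swap (R : Type*) [CommRing R] (o : LinearOrder V)
    {σ : Finset V} {v w : V} (hv : v ∉ σ) (hw : w ∉ σ) (hvw : v ≠ w) :
    coefficient R o σ (insert v σ) * coefficient R o (insert v σ) (insert w (insert v σ)) +
      coefficient R o σ (insert w σ) * coefficient R o (insert w σ) (insert w (insert v σ)) = 0 := by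
  have hwv : w ∉ insert v σ := by simp [hw, hvw.symm]
  have hvw' : v ∉ insert w σ := by simp [hv, hvw]
  rw [coefficient_insert R o hv, coefficient_insert R o hw, coefficient_insert R o hwv,
    Finset.insert_comm w v, coefficient_insert R o hvw', Finset.filter_insert, Finset.filter_insert]
  rcases @lt_or_gt_of_ne _ o _ _ hvw with h | h
  · rw [if_neg (not_lt_of_gt h), if_pos h, Finset.card_insert_of_notMem (by simp [hw])]
    ring
  · rw [if_pos h, if_neg (not_lt_of_gt h), Finset.card_insert_of_notMem (by simp [hv])]
    ring

/-- A nonzero term requires `τ = σ ∪ {v, w}`. There are then exactly two intermediate simplices, and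
their contributions cancel. -/
theorem coboundary_comp_coboundary (G : SimpleGraph V) (R : Type*) [CommRing R]
    (o : LinearOrder V) (i i' i'' : ℤ) :
    coboundary G R o i' i'' ∘ₗ coboundary G R o i i' = 0 := by
  classical
  refine Finsupp.lhom_ext fun σ r => Finsupp.ext fun τ => ?_
  rw [LinearMap.comp_apply, coboundary_apply]
  simp only [coboundary_single_apply, LinearMap.zero_apply, Finsupp.coe_zero, Pi.zero_apply,
    mul_assoc]
  rw [← Finset.mul_sum]
  convert mul_zero r
  by_cases h0 : ∀ ρ : Simplex G i', coefficient R o σ.1 ρ.1 * coefficient R o ρ.1 τ.1 = 0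
  · exact Finset.sum_eq_zero fun ρ _ => h0 ρ
  push Not at h0
  obtain ⟨ρ, hρ⟩ := h0
  obtain ⟨v, hv, hρv⟩ := exists_of_coefficient_ne_zero (left_ne_zero_of_mul hρ)
  obtain ⟨w, hw, hτw⟩ := exists_of_coefficient_ne_zero (right_ne_zero_of_mul hρ)
  have hwσ : w ∉ σ.1 := fun h => hw (by rw [hρv]; exact Finset.mem_insert_of_mem h)
  have hvw : v ≠ w := by rintro rfl; exact hw (by rw [hρv]; exact Finset.mem_insert_self _ _)
  rw [hρv] at hτw
  -- The other intermediate set is independent because it is contained in `τ`.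
  let ρ' : Simplex G i' := ⟨insert w σ.1, τ.2.1.mono (by
      rw [hτw]; simp only [Finset.coe_insert]
      exact Set.insert_subset_insert (Set.subset_insert _ _)), by
    rw [← ρ.2.2, hρv, Finset.card_insert_of_notMem hwσ, Finset.card_insert_of_notMem hv]⟩
  have hne : ρ ≠ ρ' := by
    intro h
    have : v ∈ ρ'.1 := by rw [← h, hρv]; exact Finset.mem_insert_self _ _
    simp [ρ', hvw, hv] at this
  rw [← Finset.sum_subset (Finset.subset_univ {ρ, ρ'}), Finset.sum_pair hne, hτw, hρv]
  · exact coefficient_mul_add_swap R o hv hwσ hvw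
  · intro κ _ hκ
    by_contra hne0
    obtain ⟨v', hv', hκv⟩ := exists_of_coefficient_ne_zero (left_ne_zero_of_mul hne0)
    obtain ⟨w', hw', hτw'⟩ := exists_of_coefficient_ne_zero (right_ne_zero_of_mul hne0)
    have hmem : v' ∈ insert w (insert v σ.1) := by
      rw [← hτw, hτw', hκv]; simp
    simp only [Finset.mem_insert, hv', or_false] at hmem
    apply hκ
    rcases hmem with rfl | rfl
    · simp [Subtype.ext_iff, ρ', hκv]
    · simp [Subtype.ext_iff, hρv, hκv]

open Classical in
/-- The sign of the permutation that sorts `σ` from the order `o₁` into the order `o₂`. -/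
noncomputable def reorderSign (R : Type*) [CommRing R] (o₁ o₂ : LinearOrder V) (σ : Finset V) : R :=
  ∏ u ∈ σ, (-1) ^ (σ.filter fun w => o₁.lt u w ∧ o₂.lt w u).card

omit [Fintype V] in
open Classical in
-- The new inversions are the pairs `u, v` on which the orders disagree, that is, those where
-- exactly one order puts `u` after `v`. Their number has the parity of the sum of the two
-- exponents.
theorem reorderSign_insert (R : Type*) [CommRing R] (o₁ o₂ : LinearOrder V)
    {σ : Finset V} {v : V} (hv : v ∉ σ) :
    reorderSign R o₁ o₂ (insert v σ) =
      (-1) ^ (σ.filter fun u => o₁.lt v u).card * (-1) ^ (σ.filter fun u => o₂.lt v u).card *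
        reorderSign R o₁ o₂ σ := by
  have h1 : ∀ u ∈ σ, ((insert v σ).filter fun w => o₁.lt u w ∧ o₂.lt w u).card =
      (if o₁.lt u v ∧ o₂.lt v u then 1 else 0) +
        (σ.filter fun w => o₁.lt u w ∧ o₂.lt w u).card := by
    intro u hu
    rw [Finset.filter_insert]
    split_ifs
    · rw [Finset.card_insert_of_notMem (by simp [hv]), add_comm]
    · rw [zero_add]
  have h2 : ((insert v σ).filter fun w => o₁.lt v w ∧ o₂.lt w v).card =
      (σ.filter fun w => o₁.lt v w ∧ o₂.lt w v).card := by
    rw [Finset.filter_insert, if_neg]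
    exact fun h => (@lt_irrefl _ o₁.toPreorder _) h.1
  unfold reorderSign
  rw [Finset.prod_insert hv, h2, Finset.prod_congr rfl fun u hu => by rw [h1 u hu, pow_add],
    Finset.prod_mul_distrib, ← mul_assoc]
  congr 1
  simp only [Finset.card_filter, ← Finset.prod_pow_eq_pow_sum]
  rw [← Finset.prod_mul_distrib, ← Finset.prod_mul_distrib]
  refine Finset.prod_congr rfl fun u hu => ?_
  have hne : u ≠ v := by rintro rfl; exact hv hu
  have h₁ : o₁.lt v u ↔ ¬ o₁.lt u v :=
    ⟨fun h h' => @lt_asymm _ o₁.toPreorder _ _ h h',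
      fun h => (@lt_or_gt_of_ne _ o₁ _ _ hne).resolve_left h⟩
  have h₂ : o₂.lt v u ↔ ¬ o₂.lt u v :=
    ⟨fun h h' => @lt_asymm _ o₂.toPreorder _ _ h h',
      fun h => (@lt_or_gt_of_ne _ o₂ _ _ hne).resolve_left h⟩
  by_cases hP : o₁.lt u v <;> by_cases hQ : o₂.lt u v <;> simp [h₁, h₂, hP, hQ]

omit [Fintype V] in
open Classical in
theorem reorderSign_of_mem_iff (R : Type*) [CommRing R] (o₁ o₂ : LinearOrder V)
    {σ ρ : Finset V} {v : V} (hv : v ∉ σ) (hρ : ∀ u, u ∈ ρ ↔ u = v ∨ u ∈ σ) :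
    reorderSign R o₁ o₂ ρ =
      (-1) ^ (σ.filter fun u => o₁.lt v u).card * (-1) ^ (σ.filter fun u => o₂.lt v u).card *
        reorderSign R o₁ o₂ σ := by
  rw [← reorderSign_insert R o₁ o₂ hv]
  congr 1
  ext u
  rw [hρ, Finset.mem_insert]

omit [Fintype V] in
theorem reorderSign_mul_self (R : Type*) [CommRing R] (o₁ o₂ : LinearOrder V) (σ : Finset V) :
    reorderSign R o₁ o₂ σ * reorderSign R o₁ o₂ σ = 1 := by
  unfold reorderSign
  rw [← Finset.prod_mul_distrib]
  refine Finset.prod_eq_one fun u _ => ?_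
  rw [← mul_pow]
  simp

end IndependenceComplex

/-! ### Homology mod 2 and the checkerboard colouring -/

namespace DiagramData

variable (D : DiagramData)

/-- A checkerboard colouring: among the two ends of an edge, and among two consecutive ends at a
crossing, exactly one has the black face on its left. -/
structure IsCheckerboard (c : D.End → Bool) : Prop where
  edge : ∀ d, c (D.edge d) = !c d
  rotate : ∀ x k, c (x, k + 1) = !c (x, k)

/-- A turn witnessing `Alternate` may start at an end of either colour; exchanging the colours
reduces to black. -/
theorem IsCheckerboard.compl {D : DiagramData} {c : D.End → Bool} (hc : D.IsCheckerboard c) :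
    D.IsCheckerboard fun d => !c d :=
  ⟨fun d => by rw [hc.edge], fun x k => by rw [hc.rotate]⟩

/-- The functions on the edges, as functions on their ends. -/
def edgeFun : Submodule (ZMod 2) (D.End → ZMod 2) where
  carrier := {g | ∀ d, g (D.edge d) = g d}
  add_mem' hf hg d := by simp [hf d, hg d]
  zero_mem' _ := rfl
  smul_mem' r _ hf d := by simp [hf d]

noncomputable instance : Finite D.Face := Quot.finite _

open Classical in
theorem card_isOut (h : D.IsOriented) :
    Fintype.card {d : D.End // D.IsOut d} = 2 * Fintype.card D.Crossing := by
  have e : {d : D.End // D.IsOut d} ≃ {d : D.End // ¬ D.IsOut d} :=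
    { toFun := fun d => ⟨D.edge d, fun h' => (h _).1 h' d.2⟩
      invFun := fun d => ⟨D.edge d, (h _).2 d.2⟩
      left_inv := fun d => Subtype.ext (D.edge_involutive d)
      right_inv := fun d => Subtype.ext (D.edge_involutive d) }
  have h1 := Fintype.card_congr e
  have h2 := Fintype.card_subtype_compl (fun d : D.End => D.IsOut d)
  have h3 := Fintype.card_subtype_le (fun d : D.End => D.IsOut d)
  have h4 : Fintype.card D.End = Fintype.card D.Crossing * 4 := by
    rw [Fintype.card_prod, ZMod.card]
  omega

theorem finrank_edgeFun (h : D.IsOriented) :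
    Module.finrank (ZMod 2) D.edgeFun = 2 * Fintype.card D.Crossing := by
  classical
  rw [← D.card_isOut h, ← Module.finrank_fintype_fun_eq_card (ZMod 2)]
  refine LinearEquiv.finrank_eq (LinearEquiv.ofBijective
    ((LinearMap.funLeft (ZMod 2) (ZMod 2)
      (Subtype.val : {d : D.End // D.IsOut d} → D.End)).comp D.edgeFun.subtype) ⟨?_, ?_⟩)
  · rintro ⟨f, hf⟩ ⟨g, hg⟩ hfg
    have key : ∀ d, D.IsOut d → f d = g d := fun d hd => congrFun hfg ⟨d, hd⟩
    refine Subtype.ext (funext fun d => ?_)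
    change f d = g d
    by_cases hd : D.IsOut d
    · exact key d hd
    · rw [← hf d, ← hg d]
      exact key _ ((h d).2 hd)
  · intro f
    refine ⟨⟨fun d => if hd : D.IsOut d then f ⟨d, hd⟩ else f ⟨D.edge d, (h d).2 hd⟩, ?_⟩, ?_⟩
    · intro d
      by_cases hd : D.IsOut d
      · have hd' : ¬ D.IsOut (D.edge d) := fun h' => (h d).1 h' hd
        simp only [hd, hd', dif_pos, dif_neg, not_false_eq_true, D.edge_involutive d]
      · have hd' := (h d).2 hd
        simp only [hd, hd', dif_pos, dif_neg, not_false_eq_true]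
    · funext d
      change (if hd : D.IsOut d.1 then f ⟨d.1, hd⟩ else _) = f d
      rw [dif_pos d.2]

/-- The cellular boundary from edges to crossings, modulo `2`. -/
def boundaryEdge : D.edgeFun →ₗ[ZMod 2] (D.Crossing → ZMod 2) where
  toFun g x := ∑ k, g.1 (x, k)
  map_add' f g := by ext x; simp [Finset.sum_add_distrib]
  map_smul' r f := by ext x; simp [Finset.mul_sum]

/-- The cellular boundary from faces to edges, modulo `2`. -/
def boundaryFace : (D.Face → ZMod 2) →ₗ[ZMod 2] D.edgeFun where
  toFun f := ⟨fun d => f (Quot.mk _ d) + f (Quot.mk _ (D.edge d)), fun d => by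
    change f (Quot.mk _ (D.edge d)) + f (Quot.mk _ (D.edge (D.edge d))) = _
    rw [D.edge_involutive d, add_comm]⟩
  map_add' f g := by ext d; simp only [Pi.add_apply, Submodule.coe_add]; ring
  map_smul' r f := by
    ext d; simp only [Pi.smul_apply, smul_eq_mul, RingHom.id_apply, Submodule.coe_smul]; ring

theorem face_edge (d : D.End) :
    (Quot.mk _ (D.edge d) : D.Face) = Quot.mk _ (d.1, d.2 + 1) := by
  refine Quot.sound ?_
  rw [D.edge_involutive d]

theorem boundaryEdge_boundaryFace (f : D.Face → ZMod 2) :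
    D.boundaryEdge (D.boundaryFace f) = 0 := by
  funext x
  change ∑ k, (f (Quot.mk _ (x, k)) + f (Quot.mk _ (D.edge (x, k)))) = 0
  simp only [face_edge]
  rw [Finset.sum_add_distrib,
    Fintype.sum_equiv (Equiv.addRight (1 : ZMod 4)) (fun k => f (Quot.mk _ (x, k + 1)))
      (fun k => f (Quot.mk _ (x, k))) (fun _ => rfl)]
  exact CharTwo.add_self_eq_zero _

theorem zmod_four_cases (k : ZMod 4) : k = 0 ∨ k = 1 ∨ k = 2 ∨ k = 3 := by
  revert k; decide

/-- A function in the kernel agrees on the two sides of each edge, hence on all ends at a crossing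
and along a component. One value per component determines it. -/
theorem finrank_ker_boundaryFace :
    Module.finrank (ZMod 2) (LinearMap.ker D.boundaryFace) ≤ Nat.card D.Component := by
  classical
  have : Fintype D.Component := Fintype.ofFinite _
  rw [Nat.card_eq_fintype_card, ← Module.finrank_fintype_fun_eq_card (ZMod 2)]
  let r : (D.Face → ZMod 2) →ₗ[ZMod 2] (D.Component → ZMod 2) :=
    LinearMap.funLeft _ _ fun K => Quot.mk _ (K.out, 0)
  refine LinearMap.finrank_le_finrank_of_injective
    (f := r.comp (LinearMap.ker D.boundaryFace).subtype) ?_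
  rw [← LinearMap.ker_eq_bot, LinearMap.ker_eq_bot']
  rintro ⟨f, hf⟩ h0
  have hedge : ∀ d, f (Quot.mk _ d) = f (Quot.mk _ (D.edge d)) := fun d =>
    CharTwo.add_eq_zero.1 (congrFun (congrArg Subtype.val (LinearMap.mem_ker.1 hf)) d)
  have hrot : ∀ x k, f (Quot.mk _ (x, k + 1)) = f (Quot.mk _ (x, k)) := fun x k => by
    rw [hedge (x, k), face_edge]
  have hall : ∀ x k, f (Quot.mk _ (x, k)) = f (Quot.mk _ (x, 0)) := by
    intro x k
    have h1 := hrot x 0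
    have h2 := hrot x 1
    have h3 := hrot x 2
    rw [zero_add] at h1
    rw [show (1 : ZMod 4) + 1 = 2 from rfl, h1] at h2
    rw [show (2 : ZMod 4) + 1 = 3 from rfl, h2] at h3
    rcases zmod_four_cases k with rfl | rfl | rfl | rfl
    exacts [rfl, h1, h2, h3]
  let F : D.Component → ZMod 2 := Quot.lift (fun x => f (Quot.mk _ (x, 0))) (by
    rintro x y ⟨k, l, hkl⟩
    rw [← hall x k, hedge, hkl, hall])
  refine Subtype.ext (funext fun φ => ?_)
  induction φ using Quot.ind with | _ d
  obtain ⟨x, k⟩ := d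
  change f _ = 0
  rw [hall]
  change F (Quot.mk _ x) = 0
  rw [← Quot.out_eq (Quot.mk _ x : D.Component)]
  exact congrFun h0 (Quot.mk _ x)

/-- Modulo boundaries of edges, crossings of the same component coincide, so one crossing per
component spans the quotient. -/
theorem card_le_finrank_range_boundaryEdge (h : D.IsOriented) :
    Fintype.card D.Crossing ≤
      Module.finrank (ZMod 2) (LinearMap.range D.boundaryEdge) + Nat.card D.Component := by
  classical
  have : Fintype D.Component := Fintype.ofFinite _
  let v : D.Component → (D.Crossing → ZMod 2) := fun K => Pi.single K.out 1
  let U := LinearMap.range D.boundaryEdge ⊔ Submodule.span (ZMod 2) (Set.range v)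
  have hstep : ∀ x y, (∃ k l : ZMod 4, D.edge (x, k) = (y, l)) →
      (Pi.single x 1 : D.Crossing → ZMod 2) + Pi.single y 1 ∈ LinearMap.range D.boundaryEdge := by
    rintro x y ⟨k, l, hkl⟩
    have hlk : D.edge (y, l) = (x, k) := by rw [← hkl, D.edge_involutive]
    have hne : (x, k) ≠ (y, l) := by
      intro he
      have := h (x, k)
      rw [hkl, he] at this
      tauto
    refine ⟨⟨Pi.single (x, k) 1 + Pi.single (y, l) 1, fun d => ?_⟩, ?_⟩
    · have h1 : D.edge d = (x, k) ↔ d = (y, l) := by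
        rw [← hlk, D.edge_involutive.injective.eq_iff]
      have h2 : D.edge d = (y, l) ↔ d = (x, k) := by
        rw [← hkl, D.edge_involutive.injective.eq_iff]
      simp only [Pi.add_apply, Pi.single_apply, h1, h2]
      rw [add_comm]
    · funext z
      change ∑ m, ((Pi.single (x, k) 1 + Pi.single (y, l) 1 : D.End → ZMod 2)) (z, m) = _
      simp only [Pi.add_apply, Finset.sum_add_distrib]
      congr 1 <;>
      · simp only [Pi.single_apply, Prod.mk.injEq]
        split_ifs with hz <;> simp [hz]
  have hrel : ∀ x y, (Quot.mk _ x : D.Component) = Quot.mk _ y →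
      (Pi.single x 1 : D.Crossing → ZMod 2) + Pi.single y 1 ∈ LinearMap.range D.boundaryEdge := by
    intro x y hxy
    replace hxy := Quot.eqvGen_exact hxy
    have hself : ∀ g : D.Crossing → ZMod 2, g + g = 0 := fun g =>
      funext fun x => CharTwo.add_self_eq_zero (g x)
    induction hxy with
    | rel x y h => exact hstep x y h
    | refl x =>
      rw [hself]
      exact Submodule.zero_mem _
    | symm x y _ ih => rwa [add_comm]
    | trans x y z _ _ h1 h2 =>
      have := Submodule.add_mem _ h1 h2
      rwa [add_assoc, ← add_assoc (Pi.single y 1), hself, zero_add] at this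
  have hU : U = ⊤ := by
    rw [eq_top_iff, ← (Pi.basisFun (ZMod 2) D.Crossing).span_eq, Submodule.span_le]
    rintro _ ⟨x, rfl⟩
    rw [Pi.basisFun_apply]
    have h1 : (Pi.single x 1 : D.Crossing → ZMod 2) + v (Quot.mk _ x) ∈ U :=
      Submodule.mem_sup_left (hrel x _ (Quot.out_eq _).symm)
    have h2 : v (Quot.mk _ x) ∈ U :=
      Submodule.mem_sup_right (Submodule.subset_span ⟨_, rfl⟩)
    have := Submodule.sub_mem _ h1 h2
    rwa [add_sub_cancel_right] at this
  calc Fintype.card D.Crossing = Module.finrank (ZMod 2) U := by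
        rw [hU, finrank_top, Module.finrank_fintype_fun_eq_card]
    _ ≤ _ := Submodule.finrank_add_le_finrank_add_finrank _ _
    _ ≤ _ := by
        rw [Nat.card_eq_fintype_card]
        exact Nat.add_le_add_left (finrank_range_le_card v) _

/-- A planar diagram is homologically trivial: every cycle bounds. -/
theorem range_boundaryFace (h : D.IsOriented) (hp : D.IsPlanar) :
    LinearMap.range D.boundaryFace = LinearMap.ker D.boundaryEdge := by
  classical
  have : Fintype D.Face := Fintype.ofFinite _
  refine Submodule.eq_of_le_of_finrank_le ?_ ?_
  · rintro _ ⟨f, rfl⟩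
    exact D.boundaryEdge_boundaryFace f
  -- With `c` crossings, `F` faces and `K` components, the range has rank at least `F - K` and the
  -- kernel has rank at most `2c - (c - K) = c + K`. Euler's formula gives `F - K = c + K`.
  · have h1 := D.boundaryFace.finrank_range_add_finrank_ker
    have h2 := D.boundaryEdge.finrank_range_add_finrank_ker
    have h3 := D.finrank_ker_boundaryFace
    have h4 := D.card_le_finrank_range_boundaryEdge h
    rw [D.finrank_edgeFun h] at h2
    rw [Module.finrank_fintype_fun_eq_card, ← Nat.card_eq_fintype_card] at h1
    unfold IsPlanar at hp
    omega

/-- The sum of all edges is a cycle mod 2, since four ends meet at each crossing. It bounds a set of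
faces, and these are the black ones. -/
theorem exists_isCheckerboard (h : D.IsOriented) (hp : D.IsPlanar) :
    ∃ c, D.IsCheckerboard c := by
  have hone : (⟨fun _ => 1, fun _ => rfl⟩ : D.edgeFun) ∈ LinearMap.ker D.boundaryEdge := by
    rw [LinearMap.mem_ker]
    funext x
    change ∑ _k : ZMod 4, (1 : ZMod 2) = 0
    decide
  rw [← D.range_boundaryFace h hp] at hone
  obtain ⟨f, hf⟩ := hone
  have hf' : ∀ d, f (Quot.mk _ d) + f (Quot.mk _ (D.edge d)) = 1 := fun d =>
    congrFun (congrArg Subtype.val hf) d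
  have key : ∀ a b : ZMod 2, a + b = 1 → decide (b = 1) = !decide (a = 1) := by decide
  refine ⟨fun d => decide (f (Quot.mk _ d) = 1), fun d => key _ _ (hf' d), fun x k => key _ _ ?_⟩
  rw [← hf' (x, k), face_edge]

end DiagramData

/-! ### Circles of a state as cycles of a permutation of the black ends -/

namespace LinkDiagram

variable {D : LinkDiagram} {c : D.End → Bool}

open Equiv.Perm DiagramData

theorem smooth_smooth (s : D.State) (d : D.End) : D.smooth s (D.smooth s d) = d := by
  obtain ⟨x, k⟩ := d
  unfold smooth
  cases h : s x <;> simp [h]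

theorem smooth_of_A {s : D.State} {d : D.End} (h : s d.1 = .A) :
    D.smooth s d = (d.1, 1 - d.2) := by
  unfold smooth; rw [h]

theorem smooth_of_B {s : D.State} {d : D.End} (h : s d.1 = .B) :
    D.smooth s d = (d.1, 3 - d.2) := by
  unfold smooth; rw [h]

theorem smooth_congr {s t : D.State} {d : D.End} (h : s d.1 = t d.1) :
    D.smooth s d = D.smooth t d := by
  unfold smooth; rw [h]

theorem _root_.DiagramData.IsCheckerboard.at_crossing (hc : D.IsCheckerboard c) (x : D.Crossing) :
    c (x, 1) = !c (x, 0) ∧ c (x, 2) = c (x, 0) ∧ c (x, 3) = !c (x, 0) := by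
  have h1 := hc.rotate x 0
  have h2 := hc.rotate x 1
  have h3 := hc.rotate x 2
  rw [zero_add] at h1
  rw [show (1 : ZMod 4) + 1 = 2 from rfl, h1, Bool.not_not] at h2
  rw [show (2 : ZMod 4) + 1 = 3 from rfl, h2] at h3
  exact ⟨h1, h2, h3⟩

theorem _root_.DiagramData.IsCheckerboard.smooth (hc : D.IsCheckerboard c) (s : D.State)
    (d : D.End) : c (D.smooth s d) = !c d := by
  obtain ⟨x, k⟩ := d
  obtain ⟨h1, h2, h3⟩ := hc.at_crossing x
  have e1 : (1 - 2 : ZMod 4) = 3 := rfl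
  have e2 : (1 - 3 : ZMod 4) = 2 := rfl
  have e3 : (3 - 1 : ZMod 4) = 2 := rfl
  have e4 : (3 - 2 : ZMod 4) = 1 := rfl
  unfold LinkDiagram.smooth
  rcases zmod_four_cases k with rfl | rfl | rfl | rfl <;> cases h : s x <;>
    simp [h1, h2, h3, e1, e2, e3, e4]

/-- The ends of one colour. -/
abbrev Black (c : D.End → Bool) : Type := {d : D.End // c d = true}

/-- The circles of `sD` can be oriented such that they arrive at the crossings through the black ends:
this is the permutation of these ends that leads to the next crossing. -/
def flow (hc : D.IsCheckerboard c) (s : D.State) : Equiv.Perm (Black c) where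
  toFun d := ⟨D.edge (D.smooth s d), by rw [hc.edge, hc.smooth, Bool.not_not]; exact d.2⟩
  invFun d := ⟨D.smooth s (D.edge d), by rw [hc.smooth, hc.edge, Bool.not_not]; exact d.2⟩
  left_inv d := Subtype.ext (by
    change D.smooth s (D.edge (D.edge (D.smooth s d))) = d
    rw [D.edge_involutive, smooth_smooth])
  right_inv d := Subtype.ext (by
    change D.edge (D.smooth s (D.smooth s (D.edge d))) = d
    rw [smooth_smooth, D.edge_involutive])

theorem flow_coe (hc : D.IsCheckerboard c) (s : D.State) (d : Black c) :
    (flow hc s d : D.End) = D.edge (D.smooth s d) := rfl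

/-- The first black end at a crossing. -/
def fstEnd (hc : D.IsCheckerboard c) (x : D.Crossing) : Black c :=
  if h : c (x, 0) = true then ⟨(x, 0), h⟩
  else ⟨(x, 1), by rw [(hc.at_crossing x).1]; simpa using h⟩

/-- The second black end at a crossing. -/
def sndEnd (hc : D.IsCheckerboard c) (x : D.Crossing) : Black c :=
  if h : c (x, 0) = true then ⟨(x, 2), by rw [(hc.at_crossing x).2.1]; exact h⟩
  else ⟨(x, 3), by rw [(hc.at_crossing x).2.2]; simpa using h⟩

theorem fstEnd_fst (hc : D.IsCheckerboard c) (x : D.Crossing) : (fstEnd hc x).1.1 = x := by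
  unfold fstEnd; split <;> rfl

theorem sndEnd_fst (hc : D.IsCheckerboard c) (x : D.Crossing) : (sndEnd hc x).1.1 = x := by
  unfold sndEnd; split <;> rfl

theorem sndEnd_snd (hc : D.IsCheckerboard c) (x : D.Crossing) :
    (sndEnd hc x).1.2 = (fstEnd hc x).1.2 + 2 := by
  unfold sndEnd fstEnd; split <;> rfl

theorem fstEnd_ne_sndEnd (hc : D.IsCheckerboard c) (x : D.Crossing) :
    fstEnd hc x ≠ sndEnd hc x := by
  intro h
  have := sndEnd_snd hc x
  rw [← h, left_eq_add] at this
  exact absurd this (by decide)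

theorem eq_fstEnd_or_sndEnd (hc : D.IsCheckerboard c) (d : Black c) :
    d = fstEnd hc d.1.1 ∨ d = sndEnd hc d.1.1 := by
  obtain ⟨⟨x, k⟩, h⟩ := d
  obtain ⟨h1, h2, h3⟩ := hc.at_crossing x
  unfold fstEnd sndEnd
  rcases zmod_four_cases k with rfl | rfl | rfl | rfl <;>
  · dsimp only
    split_ifs <;> simp_all

theorem flow_congr (hc : D.IsCheckerboard c) {s t : D.State} {d : Black c}
    (h : s d.1.1 = t d.1.1) : flow hc s d = flow hc t d :=
  Subtype.ext (by rw [flow_coe, flow_coe, smooth_congr h])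

/-- The two black ends at `x` differ by `2`, and `3 - k = 1 - (k + 2)` in `ZMod 4`: the `B`-arc at
one black end leads where the `A`-arc at the other does. -/
theorem flow_fstEnd (hc : D.IsCheckerboard c) {s t : D.State} {x : D.Crossing}
    (hs : s x = .B) (ht : t x = .A) : flow hc s (fstEnd hc x) = flow hc t (sndEnd hc x) := by
  refine Subtype.ext ?_
  rw [flow_coe, flow_coe, smooth_of_B (by rw [fstEnd_fst, hs]),
    smooth_of_A (by rw [sndEnd_fst, ht]), fstEnd_fst, sndEnd_fst, sndEnd_snd]
  congr 2
  generalize (fstEnd hc x).1.2 = k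
  revert k; decide

theorem flow_sndEnd (hc : D.IsCheckerboard c) {s t : D.State} {x : D.Crossing}
    (hs : s x = .B) (ht : t x = .A) : flow hc s (sndEnd hc x) = flow hc t (fstEnd hc x) := by
  refine Subtype.ext ?_
  rw [flow_coe, flow_coe, smooth_of_B (by rw [sndEnd_fst, hs]),
    smooth_of_A (by rw [fstEnd_fst, ht]), fstEnd_fst, sndEnd_fst, sndEnd_snd]
  congr 2
  generalize (fstEnd hc x).1.2 = k
  revert k; decide

theorem ne_of_crossing_ne {hc : D.IsCheckerboard c} {d : Black c} {x : D.Crossing}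
    (h : d.1.1 ≠ x) : d ≠ fstEnd hc x ∧ d ≠ sndEnd hc x :=
  ⟨fun h' => h (by rw [h', fstEnd_fst]), fun h' => h (by rw [h', sndEnd_fst])⟩

open Classical in
/-- The state with `B`-labels on `B`. -/
noncomputable def stateOn (B : Finset D.Crossing) : D.State := fun x => if x ∈ B then .B else .A

theorem stateOn_empty : stateOn (∅ : Finset D.Crossing) = D.stateA := by
  funext x; simp [stateOn, stateA]

theorem stateOn_of_mem {B : Finset D.Crossing} {x : D.Crossing} (h : x ∈ B) :
    stateOn B x = .B := if_pos h

theorem stateOn_of_notMem {B : Finset D.Crossing} {x : D.Crossing} (h : x ∉ B) :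
    stateOn B x = .A := if_neg h

open Classical in
theorem flow_insert (hc : D.IsCheckerboard c) {B : Finset D.Crossing} {y : D.Crossing}
    (hy : y ∉ B) :
    flow hc (stateOn (insert y B)) =
      flow hc (stateOn B) * Equiv.swap (fstEnd hc y) (sndEnd hc y) := by
  have hs := stateOn_of_mem (Finset.mem_insert_self y B)
  have ht := stateOn_of_notMem hy
  ext1 d
  by_cases hd : d.1.1 = y
  · subst hd
    rw [mul_apply]
    rcases eq_fstEnd_or_sndEnd hc d with h | h
    · generalize d.1.1 = y at *
      subst h
      rw [Equiv.swap_apply_left, flow_fstEnd hc hs ht]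
    · generalize d.1.1 = y at *
      subst h
      rw [Equiv.swap_apply_right, flow_sndEnd hc hs ht]
  · obtain ⟨h1, h2⟩ := ne_of_crossing_ne (hc := hc) hd
    rw [mul_swap_apply_of_ne h1 h2]
    refine flow_congr hc ?_
    simp [stateOn, hd]

/-- The two arcs of the smoothing at `x` are on one circle iff the black ends at `x` are. -/
theorem crossingCircle_mk_eq_iff (hc : D.IsCheckerboard c) (s : D.State) (d d' : Black c) :
    (Quot.mk _ d.1 : D.CrossingCircle s) = Quot.mk _ d'.1 ↔ SameCycle (flow hc s) d d' := by
  classical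
  constructor
  · intro h
    -- A white end is represented by the black end of the same smoothing arc.
    let r : D.End → Black c := fun d =>
      if h : c d = true then ⟨d, h⟩ else ⟨D.smooth s d, by rw [hc.smooth]; simpa using h⟩
    let F : D.CrossingCircle s → Quotient (SameCycle.setoid (flow hc s)) :=
      Quot.lift (fun d => Quotient.mk _ (r d)) (by
        rintro d _ (rfl | rfl) <;> refine Quotient.sound ?_ <;> change SameCycle _ _ _
        · by_cases hd : c d = true
          · have hd' : ¬ c (D.edge d) = true := by rw [hc.edge]; simpa using hd
            simp only [r, dif_pos hd, dif_neg hd']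
            rw [← sameCycle_apply_right]
            have e : flow hc s ⟨D.smooth s (D.edge d), by
                rw [hc.smooth, hc.edge, Bool.not_not]; exact hd⟩ = ⟨d, hd⟩ :=
              Subtype.ext (by rw [flow_coe, smooth_smooth, D.edge_involutive])
            rw [e]
          · have hd' : c (D.edge d) = true := by rw [hc.edge]; simpa using hd
            simp only [r, dif_neg hd, dif_pos hd']
            rw [← sameCycle_apply_left]
            have e : flow hc s ⟨D.smooth s d, by rw [hc.smooth]; simpa using hd⟩ =
                ⟨D.edge d, hd'⟩ := Subtype.ext (by rw [flow_coe, smooth_smooth])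
            rw [e]
        · by_cases hd : c d = true
          · have hd' : ¬ c (D.smooth s d) = true := by rw [hc.smooth]; simpa using hd
            simp only [r, dif_pos hd, dif_neg hd', smooth_smooth]
            exact SameCycle.refl _ _
          · have hd' : c (D.smooth s d) = true := by rw [hc.smooth]; simpa using hd
            simp only [r, dif_neg hd, dif_pos hd']
            exact SameCycle.refl _ _)
    have h' := Quotient.exact (congrArg F h)
    have hr : ∀ d : Black c, r d = d := fun d => dif_pos d.2
    rwa [hr, hr] at h'
  · intro h
    refine (h.mem_of_closed
      (S := {z | (Quot.mk _ d.1 : D.CrossingCircle s) = Quot.mk _ z.1}) (fun z hz => ?_) ?_)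
    swap
    · exact Eq.refl (Quot.mk _ d.1 : D.CrossingCircle s)
    refine Eq.trans (b := Quot.mk _ z.1) hz ?_
    refine Eq.trans (b := Quot.mk _ (D.smooth s z.1)) (Quot.sound (Or.inr rfl)) ?_
    exact Quot.sound (Or.inl rfl)

theorem card_crossingCircle (hc : D.IsCheckerboard c) (s : D.State) :
    Nat.card (D.CrossingCircle s) = numCycles (flow hc s) := by
  let F : Quotient (SameCycle.setoid (flow hc s)) → D.CrossingCircle s :=
    Quotient.lift (fun d => Quot.mk _ d.1) fun d d' h => (crossingCircle_mk_eq_iff hc s d d').2 h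
  refine (Nat.card_congr (Equiv.ofBijective F ⟨?_, ?_⟩)).symm
  · intro a b
    induction a using Quotient.inductionOn
    induction b using Quotient.inductionOn
    exact fun h => Quotient.sound ((crossingCircle_mk_eq_iff hc s _ _).1 h)
  · intro C
    induction C using Quot.ind with | _ d
    by_cases hd : c d = true
    · exact ⟨Quotient.mk _ ⟨d, hd⟩, rfl⟩
    · refine ⟨Quotient.mk _ ⟨D.smooth s d, by rw [hc.smooth]; simpa using hd⟩, ?_⟩
      exact (Quot.sound (r := fun d d' => d' = D.edge d ∨ d' = D.smooth s d) (Or.inr rfl)).symm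

/-- The ends `0, 1` share an `A`-arc, as do `2, 3`, so the black pair, be it `0, 2` or `1, 3`, has
one end on each arc. -/
theorem isAdmissible_iff (hc : D.IsCheckerboard c) (x : D.Crossing) :
    D.IsAdmissible x ↔ SameCycle (flow hc D.stateA) (fstEnd hc x) (sndEnd hc x) := by
  rw [← crossingCircle_mk_eq_iff]
  have harc : ∀ k : ZMod 4, (Quot.mk _ (x, k) : D.CrossingCircle D.stateA) = Quot.mk _ (x, 1 - k) :=
    fun k => Quot.sound (Or.inr (smooth_of_A (s := D.stateA) (d := (x, k)) rfl).symm)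
  have h1 := harc 0
  have h3 := harc 2
  rw [sub_zero] at h1
  rw [show (1 - 2 : ZMod 4) = 3 from rfl] at h3
  unfold IsAdmissible circleAt
  rw [Sum.inl.injEq]
  unfold fstEnd sndEnd
  split_ifs
  · rfl
  · rw [h1, h3]

theorem travel_iterate_coe (hc : D.IsCheckerboard c) (d : Black c) (k : ℕ) :
    D.travel^[k] d.1 = ((flow hc D.stateA ^ k) d).1 := by
  induction k with
  | zero => rfl
  | succ k ih => rw [Function.iterate_succ_apply', ih, pow_succ']; rfl

theorem minimalPeriod_travel (hc : D.IsCheckerboard c) (d : Black c) :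
    Function.minimalPeriod D.travel d.1 = Function.minimalPeriod (flow hc D.stateA) d := by
  rw [Function.minimalPeriod_eq_minimalPeriod_iff]
  intro n
  unfold Function.IsPeriodicPt Function.IsFixedPt
  rw [travel_iterate_coe hc, iterate_eq_pow, Subtype.ext_iff]

theorem eq_pair_of_ne (hc : D.IsCheckerboard c) {x : D.Crossing} {d d' : Black c}
    (hd : d.1.1 = x) (hd' : d'.1.1 = x) (hne : d ≠ d') :
    d = fstEnd hc x ∧ d' = sndEnd hc x ∨ d = sndEnd hc x ∧ d' = fstEnd hc x := by
  have h1 := eq_fstEnd_or_sndEnd hc d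
  have h2 := eq_fstEnd_or_sndEnd hc d'
  rw [hd] at h1
  rw [hd'] at h2
  rcases h1 with h1 | h1 <;> rcases h2 with h2 | h2
  · exact absurd (h1.trans h2.symm) hne
  · exact Or.inl ⟨h1, h2⟩
  · exact Or.inr ⟨h1, h2⟩
  · exact absurd (h1.trans h2.symm) hne

end LinkDiagram

/-! ### Alternating chords and the states with the greatest gain of circles -/

namespace LinkDiagram

variable {D : LinkDiagram} {c : D.End → Bool}

open Equiv.Perm DiagramData

open Classical in
theorem alternate_of_not_sameCycle (hc : D.IsCheckerboard c) {x y : D.Crossing} (hxy : x ≠ y)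
    (hx : D.IsAdmissible x) (hy : D.IsAdmissible y)
    (h : ¬ SameCycle (flow hc D.stateA * Equiv.swap (fstEnd hc y) (sndEnd hc y))
      (fstEnd hc x) (sndEnd hc x)) : D.Alternate x y := by
  have hne : ∀ {d d' : Black c}, d.1.1 = x → d'.1.1 = y → d ≠ d' := by
    rintro d d' h h' rfl
    exact hxy (h.symm.trans h')
  obtain ⟨k, l, m, hk, hkl, hlm, hm, hl, hkm⟩ :=
    exists_alternating_of_not_sameCycle (fstEnd_ne_sndEnd hc y) ((isAdmissible_iff hc y).1 hy)
      ((isAdmissible_iff hc x).1 hx) h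
      (hne (fstEnd_fst hc x) (fstEnd_fst hc y)) (hne (fstEnd_fst hc x) (sndEnd_fst hc y))
      (hne (sndEnd_fst hc x) (fstEnd_fst hc y)) (hne (sndEnd_fst hc x) (sndEnd_fst hc y))
  -- The turn produced by the cut at `y` starts at `y`, hence the symmetry.
  refine Alternate.symm D ⟨(fstEnd hc y).1, k, l, m, hk, hkl, hlm, ?_, fstEnd_fst hc y, ?_, ?_, ?_⟩
  · rwa [minimalPeriod_travel hc]
  · rw [travel_iterate_coe hc]
    rcases hkm with ⟨h, -⟩ | ⟨h, -⟩ <;> rw [h]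
    exacts [fstEnd_fst hc x, sndEnd_fst hc x]
  · rw [travel_iterate_coe hc, hl, sndEnd_fst]
  · rw [travel_iterate_coe hc]
    rcases hkm with ⟨-, h⟩ | ⟨-, h⟩ <;> rw [h]
    exacts [sndEnd_fst hc x, fstEnd_fst hc x]

open Classical in
/-- Chords that alternate along the circle through a black end are separated by one another. -/
theorem not_sameCycle_of_black (hc : D.IsCheckerboard c) {x y : D.Crossing} {d : D.End}
    (hd : c d = true) {k l m : ℕ} (hk : 0 < k) (hkl : k < l) (hlm : l < m)
    (hm : m < Function.minimalPeriod D.travel d) (h0 : d.1 = x) (h1 : (D.travel^[k] d).1 = y)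
    (h2 : (D.travel^[l] d).1 = x) (h3 : (D.travel^[m] d).1 = y) :
    ¬ SameCycle (flow hc D.stateA * Equiv.swap (fstEnd hc y) (sndEnd hc y))
      (fstEnd hc x) (sndEnd hc x) := by
  lift d to Black c using hd
  rw [minimalPeriod_travel hc] at hm
  rw [travel_iterate_coe hc] at h1 h2 h3
  have key := not_sameCycle_of_alternating hk hkl hlm hm
  have hinj : ∀ i j, i ≤ m → j ≤ m → (flow hc D.stateA ^ i) d = (flow hc D.stateA ^ j) d →
      i = j := by
    intro i j hi hj hij
    rw [← iterate_eq_pow, ← iterate_eq_pow] at hij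
    exact Function.iterate_injOn_Iio_minimalPeriod (Set.mem_Iio.2 (by omega))
      (Set.mem_Iio.2 (by omega)) hij
  have hx := eq_pair_of_ne hc h0 h2 fun h => by
    have := hinj 0 l (by omega) hlm.le (by simpa using h); omega
  have hy := eq_pair_of_ne hc h1 h3 fun h => by
    have := hinj k m (by omega) le_rfl h; omega
  rcases hy with ⟨e1, e2⟩ | ⟨e1, e2⟩ <;> rw [e1, e2] at key <;>
    rcases hx with ⟨e3, e4⟩ | ⟨e3, e4⟩ <;> rw [e4, e3] at key
  · exact key
  · exact fun h => key h.symm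
  · rwa [Equiv.swap_comm]
  · rw [Equiv.swap_comm]
    exact fun h => key h.symm

/-- The number of circles of a state that meet some crossing. -/
noncomputable def numCircles (B : Finset D.Crossing) : ℕ :=
  Nat.card (D.CrossingCircle (stateOn B))

theorem numCircles_eq (hc : D.IsCheckerboard c) (B : Finset D.Crossing) :
    numCircles B = numCycles (flow hc (stateOn B)) := card_crossingCircle hc _

variable (D) in
theorem exists_isCheckerboard : ∃ c, D.IsCheckerboard c :=
  DiagramData.exists_isCheckerboard _ D.oriented D.planar

open Classical in
theorem numCircles_insert_le (y : D.Crossing) (B : Finset D.Crossing) :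
    numCircles (insert y B) ≤ numCircles B + 1 := by
  obtain ⟨c, hc⟩ := D.exists_isCheckerboard
  by_cases hy : y ∈ B
  · rw [Finset.insert_eq_of_mem hy]; omega
  · rw [numCircles_eq hc, numCircles_eq hc, flow_insert hc hy]
    exact numCycles_mul_swap_le (fstEnd_ne_sndEnd hc y)

open Classical in
theorem numCircles_union_le (B C : Finset D.Crossing) :
    numCircles (B ∪ C) ≤ numCircles B + C.card := by
  induction C using Finset.induction_on with
  | empty => simp
  | insert y C hy ih =>
    rw [Finset.union_insert, Finset.card_insert_of_notMem hy]
    have := numCircles_insert_le y (B ∪ C)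
    omega

theorem numCircles_le (B : Finset D.Crossing) :
    numCircles B ≤ numCircles (∅ : Finset D.Crossing) + B.card := by
  classical
  simpa using numCircles_union_le ∅ B

open Classical in
-- Passing from `C` to `B` gains at most `|B \ C|` circles, so a deficit at `C` could not be made
-- up.
theorem numCircles_subset {B C : Finset D.Crossing} (h : C ⊆ B)
    (hB : numCircles B = numCircles (∅ : Finset D.Crossing) + B.card) :
    numCircles C = numCircles (∅ : Finset D.Crossing) + C.card := by
  have h1 := numCircles_union_le C (B \ C)
  rw [Finset.union_sdiff_of_subset h] at h1
  have h2 := numCircles_le C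
  have h3 := Finset.card_sdiff_add_card_eq_card h
  omega

open Classical in
theorem sameCycle_of_numCircles (hc : D.IsCheckerboard c) {y : D.Crossing} {B : Finset D.Crossing}
    (hy : y ∉ B) (h : numCircles B < numCircles (insert y B)) :
    SameCycle (flow hc (stateOn B)) (fstEnd hc y) (sndEnd hc y) := by
  rw [numCircles_eq hc, numCircles_eq hc, flow_insert hc hy] at h
  exact sameCycle_of_numCycles_lt h

/-- The subset `{x}` also has maximal gain, so smoothing at `x` alone splits a circle of `s_A D`. -/
theorem isAdmissible_of_numCircles {B : Finset D.Crossing}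
    (hB : numCircles B = numCircles (∅ : Finset D.Crossing) + B.card) {x : D.Crossing}
    (hx : x ∈ B) : D.IsAdmissible x := by
  classical
  obtain ⟨c, hc⟩ := D.exists_isCheckerboard
  rw [isAdmissible_iff hc, ← stateOn_empty]
  refine sameCycle_of_numCircles hc (by simp) ?_
  have := numCircles_subset (C := insert x ∅) (by simpa using hx) hB
  rw [this]
  simp

theorem not_alternate_of_numCircles {B : Finset D.Crossing}
    (hB : numCircles B = numCircles (∅ : Finset D.Crossing) + B.card) {x y : D.Crossing}
    (hx : x ∈ B) (hy : y ∈ B) (hxy : x ≠ y) : ¬ D.Alternate x y := by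
  classical
  -- By maximality on `{y}` and `{x, y}`, smoothing at `x` after `y` still splits a circle, so the
  -- cut at `y` does not separate the ends at `x`. Both colourings are needed below.
  have key : ∀ {c : D.End → Bool} (hc : D.IsCheckerboard c),
      SameCycle (flow hc D.stateA * Equiv.swap (fstEnd hc y) (sndEnd hc y))
        (fstEnd hc x) (sndEnd hc x) := by
    intro c hc
    rw [← stateOn_empty, ← flow_insert hc (by simp)]
    have hx' : x ∉ insert y (∅ : Finset D.Crossing) := by simpa using hxy
    refine sameCycle_of_numCircles hc hx' ?_
    rw [numCircles_subset (C := insert y ∅) (by simpa using hy) hB,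
      numCircles_subset (C := insert x (insert y ∅)) (by
        intro z hz
        simp only [Finset.mem_insert, Finset.notMem_empty, or_false] at hz
        rcases hz with rfl | rfl <;> assumption) hB, Finset.card_insert_of_notMem hx']
    omega
  obtain ⟨c, hc⟩ := D.exists_isCheckerboard
  rintro ⟨d, k, l, m, hk, hkl, hlm, hm, h0, h1, h2, h3⟩
  by_cases hd : c d = true
  · exact not_sameCycle_of_black hc hd hk hkl hlm hm h0 h1 h2 h3 (key hc)
  · exact not_sameCycle_of_black hc.compl (by simpa using hd) hk hkl hlm hm h0 h1 h2 h3
      (key hc.compl)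

/-- The circle of `y` is cut into two by the chord at `y`, and the smoothings along chords which do
not alternate with it preserve the two parts. -/
theorem sameCycle_flow_of_nonalternating (hc : D.IsCheckerboard c) {B : Finset D.Crossing}
    {y : D.Crossing} (hyB : y ∉ B) (hy : D.IsAdmissible y) (hB : ∀ x ∈ B, D.IsAdmissible x)
    (hBy : ∀ x ∈ B, ¬ D.Alternate x y) :
    SameCycle (flow hc (stateOn B)) (fstEnd hc y) (sndEnd hc y) := by
  classical
  set q := flow hc D.stateA * Equiv.swap (fstEnd hc y) (sndEnd hc y) with hq
  have hsame : ∀ x ∈ B, SameCycle q (fstEnd hc x) (sndEnd hc x) := by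
    intro x hx
    by_contra h
    refine hBy x hx (alternate_of_not_sameCycle hc ?_ (hB x hx) hy h)
    rintro rfl
    exact hyB hx
  have hsep : ¬ SameCycle q (fstEnd hc y) (sndEnd hc y) :=
    ((isAdmissible_iff hc y).1 hy).not_sameCycle_mul_swap (fstEnd_ne_sndEnd hc y)
  -- If the two ends at `y` lay on different cycles, the swap at `y` would merge these. But the flow
  -- for `insert y B` preserves each cycle of `q`, and `q` separates the two ends.
  by_contra hcon
  have h1 := sameCycle_mul_swap_of_not_sameCycle hcon
  rw [← flow_insert hc hyB] at h1
  refine hsep (h1.mem_of_closed (S := {z | SameCycle q (fstEnd hc y) z}) ?_ (SameCycle.refl _ _))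
  intro z hz
  have hz : SameCycle q (fstEnd hc y) z := hz
  change SameCycle q _ _
  have hq' : q = flow hc (stateOn (insert y ∅)) := by
    rw [hq, flow_insert hc (by simp), stateOn_empty]
  -- At a crossing of `B` the flow acts as `q` on the other black end, which lies on the same cycle
  -- of `q` by `hsame`.
  by_cases hzB : z.1.1 ∈ B
  · have hzy : z.1.1 ≠ y := by rintro h; exact hyB (h ▸ hzB)
    have hs := stateOn_of_mem (Finset.mem_insert_of_mem (b := y) hzB)
    have hA : D.stateA z.1.1 = .A := rfl
    have hx := hsame _ hzB
    have hq1 := mul_swap_apply_of_ne (p := flow hc D.stateA)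
      (ne_of_crossing_ne (hc := hc) (d := fstEnd hc z.1.1) (by rwa [fstEnd_fst])).1
      (ne_of_crossing_ne (hc := hc) (d := fstEnd hc z.1.1) (by rwa [fstEnd_fst])).2
    have hq2 := mul_swap_apply_of_ne (p := flow hc D.stateA)
      (ne_of_crossing_ne (hc := hc) (d := sndEnd hc z.1.1) (by rwa [sndEnd_fst])).1
      (ne_of_crossing_ne (hc := hc) (d := sndEnd hc z.1.1) (by rwa [sndEnd_fst])).2
    rw [← hq] at hq1 hq2
    have hcase := eq_fstEnd_or_sndEnd hc z
    generalize z.1.1 = x at *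
    rcases hcase with h | h <;> subst h
    · rw [flow_fstEnd hc hs hA, ← hq2, sameCycle_apply_right]
      exact hz.trans hx
    · rw [flow_sndEnd hc hs hA, ← hq1, sameCycle_apply_right]
      exact hz.trans hx.symm
  · have : flow hc (stateOn (insert y B)) z = q z := by
      rw [hq']
      refine flow_congr hc ?_
      simp [stateOn, hzB]
    rw [this, sameCycle_apply_right]
    exact hz

theorem numCircles_of_nonalternating {B : Finset D.Crossing} (hB : ∀ x ∈ B, D.IsAdmissible x)
    (hBB : ∀ x ∈ B, ∀ y ∈ B, x ≠ y → ¬ D.Alternate x y) :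
    numCircles B = numCircles (∅ : Finset D.Crossing) + B.card := by
  classical
  obtain ⟨c, hc⟩ := D.exists_isCheckerboard
  induction B using Finset.induction_on with
  | empty => simp
  | insert y B hy ih =>
    have ih := ih (fun x hx => hB x (Finset.mem_insert_of_mem hx)) fun x hx z hz =>
      hBB x (Finset.mem_insert_of_mem hx) z (Finset.mem_insert_of_mem hz)
    have h := sameCycle_flow_of_nonalternating hc hy (hB y (Finset.mem_insert_self _ _))
      (fun x hx => hB x (Finset.mem_insert_of_mem hx)) fun x hx =>
      hBB x (Finset.mem_insert_of_mem hx) y (Finset.mem_insert_self _ _) (by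
        rintro rfl; exact hy hx)
    rw [Finset.card_insert_of_notMem hy, ← add_assoc, ← ih, numCircles_eq hc, flow_insert hc hy,
      h.numCycles_mul_swap (fstEnd_ne_sndEnd hc y), numCircles_eq hc]

end LinkDiagram

/-! ### Signed isomorphisms of free modules and induced maps on cohomology -/

section Algebra

variable {R : Type*} [CommRing R]

/-- An equivalence of bases together with a choice of signs. -/
noncomputable def Finsupp.signedEquiv {X Y : Type*} (e : X ≃ Y) (u : X → R)
    (hu : ∀ x, u x * u x = 1) : (X →₀ R) ≃ₗ[R] (Y →₀ R) :=
  LinearEquiv.ofLinearMap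
    (Finsupp.linearCombination R fun x => Finsupp.single (e x) (u x))
    (Finsupp.linearCombination R fun y => Finsupp.single (e.symm y) (u (e.symm y)))
    (Finsupp.lhom_ext fun y r => by
      rw [LinearMap.comp_apply, Finsupp.linearCombination_single, Finsupp.smul_single,
        Finsupp.linearCombination_single, Finsupp.smul_single, e.apply_symm_apply, smul_eq_mul,
        smul_eq_mul, mul_assoc, hu, mul_one, LinearMap.id_apply])
    (Finsupp.lhom_ext fun x r => by
      rw [LinearMap.comp_apply, Finsupp.linearCombination_single, Finsupp.smul_single,
        Finsupp.linearCombination_single, Finsupp.smul_single, e.symm_apply_apply, smul_eq_mul,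
        smul_eq_mul, mul_assoc, hu, mul_one, LinearMap.id_apply])

theorem Finsupp.signedEquiv_single {X Y : Type*} (e : X ≃ Y) (u : X → R)
    (hu : ∀ x, u x * u x = 1) (x : X) (r : R) :
    Finsupp.signedEquiv e u hu (Finsupp.single x r) = Finsupp.single (e x) (r * u x) := by
  change Finsupp.linearCombination R (fun x => Finsupp.single (e x) (u x)) _ = _
  rw [Finsupp.linearCombination_single, Finsupp.smul_single, smul_eq_mul]

theorem Finsupp.signedEquiv_apply {X Y : Type*} (e : X ≃ Y) (u : X → R)
    (hu : ∀ x, u x * u x = 1) (f : X →₀ R) (x : X) :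
    Finsupp.signedEquiv e u hu f (e x) = f x * u x := by
  classical
  induction f using Finsupp.induction_linear with
  | zero => simp
  | add f g hf hg => simp [hf, hg, add_mul]
  | single z r =>
    rw [Finsupp.signedEquiv_single, Finsupp.single_apply, Finsupp.single_apply]
    by_cases h : z = x
    · simp [h]
    · simp [h]

/-- An isomorphism of pairs of composable maps induces one of the cohomology modules. -/
theorem MiddleCohomology.nonempty_linearEquiv {A B C A' B' C' : Type*}
    [AddCommGroup A] [AddCommGroup B] [AddCommGroup C] [Module R A] [Module R B] [Module R C]
    [AddCommGroup A'] [AddCommGroup B'] [AddCommGroup C'] [Module R A'] [Module R B'] [Module R C']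
    {f : A →ₗ[R] B} {g : B →ₗ[R] C} {f' : A' →ₗ[R] B'} {g' : B' →ₗ[R] C'}
    (a : A ≃ₗ[R] A') (b : B ≃ₗ[R] B') (c : C ≃ₗ[R] C')
    (hf : f' ∘ₗ a.toLinearMap = b.toLinearMap ∘ₗ f)
    (hg : g' ∘ₗ b.toLinearMap = c.toLinearMap ∘ₗ g) :
    Nonempty (MiddleCohomology f g ≃ₗ[R] MiddleCohomology f' g') := by
  have hf : ∀ x, f' (a x) = b (f x) := LinearMap.congr_fun hf
  have hg : ∀ x, g' (b x) = c (g x) := LinearMap.congr_fun hg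
  have hker : (LinearMap.ker g).map b.toLinearMap = LinearMap.ker g' := by
    ext y
    constructor
    · rintro ⟨x, hx, rfl⟩
      have hx : g x = 0 := hx
      change g' (b x) = 0
      rw [hg, hx, map_zero]
    · intro hy
      have hy : g' y = 0 := hy
      refine ⟨b.symm y, ?_, b.apply_symm_apply y⟩
      change g (b.symm y) = 0
      apply c.injective
      rw [← hg, b.apply_symm_apply, hy, map_zero]
  let e : LinearMap.ker g ≃ₗ[R] LinearMap.ker g' := LinearEquiv.ofSubmodules b _ _ hker
  have he : ((LinearMap.range f).submoduleOf (LinearMap.ker g)).map e.toLinearMap =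
      (LinearMap.range f').submoduleOf (LinearMap.ker g') := by
    ext y
    constructor
    · rintro ⟨x, ⟨z, hz⟩, rfl⟩
      have hz : f z = x := hz
      exact ⟨a z, (hf z).trans (congrArg b hz)⟩
    · rintro ⟨z, hz⟩
      have hz : f' z = y := hz
      refine ⟨e.symm y, ⟨a.symm z, ?_⟩, e.apply_symm_apply y⟩
      apply b.injective
      rw [← hf, a.apply_symm_apply, hz]
      exact (congrArg Subtype.val (e.apply_symm_apply y)).symm
  exact ⟨Submodule.Quotient.equiv _ _ e he⟩

end Algebra

/-! ### The enhanced states of minimal `j` -/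

namespace LinkDiagram

variable {D : LinkDiagram}

namespace EnhancedState

/-- The crossings with label `B`. -/
noncomputable def bSet (s : D.EnhancedState) : Finset D.Crossing :=
  Finset.univ.filter fun x => s.label x = .B

theorem mem_bSet {s : D.EnhancedState} {x : D.Crossing} : x ∈ s.bSet ↔ s.label x = .B := by
  simp [bSet]

theorem notMem_bSet {s : D.EnhancedState} {x : D.Crossing} : x ∉ s.bSet ↔ s.label x = .A := by
  rw [mem_bSet]
  cases s.label x <;> simp

theorem stateOn_bSet (s : D.EnhancedState) : stateOn s.bSet = s.label := by
  funext x
  cases h : s.label x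
  · exact stateOn_of_notMem (notMem_bSet.2 h)
  · exact stateOn_of_mem (mem_bSet.2 h)

/-- With `c` crossings, `w = c - 2n` and `σ = c - 2|B|`. -/
theorem degI_eq_card_sub (s : D.EnhancedState) : s.degI = (s.bSet.card : ℤ) - D.numNeg := by
  classical
  have h1 : D.numPos + D.numNeg = Fintype.card D.Crossing := by
    have h : ∀ x : D.Crossing, D.sign x = -1 ↔ ¬ D.sign x = 1 := by
      intro x
      rcases Int.units_eq_one_or (D.sign x) with h | h <;> rw [h] <;> decide
    unfold numPos numNeg
    simp only [h]
    exact Finset.card_filter_add_card_filter_not _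
  have h2 : s.a + s.b = Fintype.card D.Crossing := by
    have h : ∀ x : D.Crossing, s.label x = .B ↔ ¬ s.label x = .A := by
      intro x
      cases s.label x <;> simp
    unfold a b
    simp only [h]
    exact Finset.card_filter_add_card_filter_not _
  have h3 := s.two_mul_degI
  have h4 : s.b = s.bSet.card := rfl
  unfold writhe sigma at h3
  omega

theorem card_circle (s : D.EnhancedState) :
    Fintype.card (D.Circle s.label) = numCircles s.bSet + D.freeCircles := by
  rw [← Nat.card_eq_fintype_card, Nat.card_sum, numCircles, stateOn_bSet, Nat.card_fin]

/-- The summands on the right are nonnegative, which gives both the lower bound for `τ` and its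
equality case. -/
theorem tau_add_card (s : D.EnhancedState) :
    s.tau + Fintype.card (D.Circle s.label) = ∑ C, (((s.sgn C : ℤˣ) : ℤ) + 1) := by
  rw [Finset.sum_add_distrib, tau]
  simp

theorem coe_sgn_add_one_nonneg (s : D.EnhancedState) (C : D.Circle s.label) :
    0 ≤ ((s.sgn C : ℤˣ) : ℤ) + 1 := by
  rcases Int.units_eq_one_or (s.sgn C) with h | h <;> rw [h] <;> decide

theorem neg_card_le_tau (s : D.EnhancedState) : -(Fintype.card (D.Circle s.label) : ℤ) ≤ s.tau := by
  have := s.tau_add_card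
  have h := Finset.sum_nonneg fun C (_ : C ∈ Finset.univ) => s.coe_sgn_add_one_nonneg C
  omega

theorem tau_eq_neg_card_iff (s : D.EnhancedState) :
    s.tau = -(Fintype.card (D.Circle s.label) : ℤ) ↔ ∀ C, s.sgn C = -1 := by
  rw [eq_neg_iff_add_eq_zero, tau_add_card,
    Finset.sum_eq_zero_iff_of_nonneg fun C _ => s.coe_sgn_add_one_nonneg C]
  refine ⟨fun h C => ?_, fun h C _ => by rw [h]; rfl⟩
  have := h C (Finset.mem_univ _)
  rcases Int.units_eq_one_or (s.sgn C) with h | h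
  · rw [h] at this; exact absurd this (by decide)
  · exact h

/-- The enhanced state with `B`-labels on `B` and all signs negative. -/
noncomputable def negative (B : Finset D.Crossing) : D.EnhancedState := ⟨stateOn B, fun _ => -1⟩

theorem bSet_negative (B : Finset D.Crossing) : (negative B).bSet = B := by
  ext x
  rw [mem_bSet]
  change stateOn B x = _ ↔ _
  by_cases h : x ∈ B
  · simp [stateOn_of_mem h, h]
  · simp [stateOn_of_notMem h, h]

theorem eq_negative {s : D.EnhancedState} (h : ∀ C, s.sgn C = -1) : s = negative s.bSet := by
  have hl := s.stateOn_bSet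
  generalize s.bSet = B at hl
  obtain ⟨l, g⟩ := s
  change stateOn B = l at hl
  subst hl
  have : g = fun _ => -1 := funext h
  rw [this, negative]

end EnhancedState

open EnhancedState

theorem degJ_ge (s : D.EnhancedState) :
    D.writhe - D.numNeg - numCircles (∅ : Finset D.Crossing) - D.freeCircles ≤ s.degJ := by
  have h1 := s.neg_card_le_tau
  have h2 := s.degI_eq_card_sub
  have h3 := s.card_circle
  have h4 := numCircles_le s.bSet
  unfold degJ
  omega

theorem degJ_eq_iff (s : D.EnhancedState) :
    s.degJ = D.writhe - D.numNeg - numCircles (∅ : Finset D.Crossing) - D.freeCircles ↔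
      (∀ C, s.sgn C = -1) ∧
        numCircles s.bSet = numCircles (∅ : Finset D.Crossing) + s.bSet.card := by
  rw [← tau_eq_neg_card_iff]
  have h1 := s.neg_card_le_tau
  have h2 := s.degI_eq_card_sub
  have h3 := s.card_circle
  have h4 := numCircles_le s.bSet
  unfold degJ
  omega

theorem jMin_eq : D.jMin =
    D.writhe - D.numNeg - numCircles (∅ : Finset D.Crossing) - D.freeCircles := by
  refine D.isLeast_jMin.unique ⟨⟨negative ∅, ?_⟩, ?_⟩
  · refine (degJ_eq_iff _).2 ⟨fun _ => rfl, ?_⟩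
    rw [bSet_negative, Finset.card_empty, add_zero]
  · rintro _ ⟨s, rfl⟩
    exact degJ_ge s

/-- The extreme enhanced states have only negative signs, and their `B`-labels are at admissible
chords which do not alternate. -/
theorem degJ_eq_jMin_iff (s : D.EnhancedState) :
    s.degJ = D.jMin ↔ (∀ C, s.sgn C = -1) ∧ (∀ x ∈ s.bSet, D.IsAdmissible x) ∧
      ∀ x ∈ s.bSet, ∀ y ∈ s.bSet, x ≠ y → ¬ D.Alternate x y := by
  rw [jMin_eq, degJ_eq_iff]
  refine and_congr_right fun _ => ⟨fun h => ⟨fun x hx => isAdmissible_of_numCircles h hx,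
    fun x hx y hy hxy => not_alternate_of_numCircles h hx hy hxy⟩, fun h => ?_⟩
  exact numCircles_of_nonalternating h.1 h.2

open Classical in
/-- The admissible chords at the crossings of `B`. -/
noncomputable def chords (B : Finset D.Crossing) : Finset D.LandoVertex :=
  Finset.univ.filter fun v => v.1 ∈ B

theorem mem_chords {B : Finset D.Crossing} {v : D.LandoVertex} : v ∈ chords B ↔ v.1 ∈ B := by
  simp [chords]

theorem map_chords {B : Finset D.Crossing} (hB : ∀ x ∈ B, D.IsAdmissible x) :
    (chords B).map (Function.Embedding.subtype _) = B := by
  ext x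
  simp only [Finset.mem_map, mem_chords, Function.Embedding.coe_subtype, Subtype.exists,
    exists_and_left, exists_prop]
  exact ⟨fun h => by simp_all, fun h => by simp_all⟩

theorem chords_map (σ : Finset D.LandoVertex) :
    chords (σ.map (Function.Embedding.subtype _)) = σ := by
  ext v
  rw [mem_chords]
  exact Finset.mem_map' (Function.Embedding.subtype _) (a := v)

theorem card_chords {B : Finset D.Crossing} (hB : ∀ x ∈ B, D.IsAdmissible x) :
    (chords B).card = B.card := by
  rw [← Finset.card_map (Function.Embedding.subtype _), map_chords hB]

/-! ### Comparison of the two complexes -/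

open IndependenceComplex

variable {i i' m m' : ℤ}

theorem Generator.sgn (s : D.Generator i D.jMin) : ∀ C, s.1.sgn C = -1 :=
  ((degJ_eq_jMin_iff s.1).1 s.2.2).1

theorem Generator.isAdmissible (s : D.Generator i D.jMin) : ∀ x ∈ s.1.bSet, D.IsAdmissible x :=
  ((degJ_eq_jMin_iff s.1).1 s.2.2).2.1

/-- The simplex of an extreme enhanced state: the chords at its `B`-labelled crossings. -/
noncomputable def toSimplex (h : m = i - 1 + D.numNeg) (s : D.Generator i D.jMin) :
    Simplex D.landoGraph m :=
  ⟨chords s.1.bSet, by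
    intro v hv w hw hvw hadj
    exact ((degJ_eq_jMin_iff s.1).1 s.2.2).2.2 v.1 (mem_chords.1 hv) w.1 (mem_chords.1 hw)
      (fun h => hvw (Subtype.ext h)) hadj.2, by
    have h1 := s.1.degI_eq_card_sub
    have h2 := s.2.1
    rw [card_chords s.isAdmissible]
    omega⟩

theorem toSimplex_bijective (h : m = i - 1 + D.numNeg) :
    Function.Bijective (toSimplex h : D.Generator i D.jMin → _) := by
  constructor
  · intro s t hst
    have hst : chords s.1.bSet = chords t.1.bSet := congrArg Subtype.val hst
    have hB : s.1.bSet = t.1.bSet := by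
      rw [← map_chords s.isAdmissible, ← map_chords t.isAdmissible, hst]
    exact Subtype.ext (by rw [eq_negative s.sgn, eq_negative t.sgn, hB])
  · rintro ⟨σ, hσ, hcard⟩
    refine ⟨⟨negative (σ.map (Function.Embedding.subtype _)), ?_, ?_⟩, ?_⟩
    · rw [degI_eq_card_sub, bSet_negative, Finset.card_map]
      omega
    · rw [degJ_eq_jMin_iff, bSet_negative]
      refine ⟨fun _ => rfl, ?_, ?_⟩
      · intro x hx
        obtain ⟨v, -, rfl⟩ := Finset.mem_map.1 hx
        exact v.2
      · intro x hx y hy hxy halt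
        obtain ⟨v, hv, rfl⟩ := Finset.mem_map.1 hx
        obtain ⟨w, hw, rfl⟩ := Finset.mem_map.1 hy
        have hvw : v ≠ w := fun h => hxy (by rw [h])
        exact hσ hv hw hvw ⟨hvw, halt⟩
    · refine Subtype.ext ?_
      change chords (bSet _) = σ
      rw [bSet_negative, chords_map]

/-- Extreme enhanced states correspond to simplices of the independence complex. -/
noncomputable def generatorEquiv (h : m = i - 1 + D.numNeg) :
    D.Generator i D.jMin ≃ Simplex D.landoGraph m :=
  Equiv.ofBijective _ (toSimplex_bijective h)

theorem generatorEquiv_coe (h : m = i - 1 + D.numNeg) (s : D.Generator i D.jMin) :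
    (generatorEquiv h s).1 = chords s.1.bSet := rfl

/-- Between extreme states the conditions on `j` and on the signs hold automatically, all signs
being negative; the condition on `i` follows by counting `B`-labels. -/
theorem adjacentAt_iff (s : D.Generator i D.jMin) (t : D.Generator i' D.jMin) (x : D.Crossing) :
    s.1.AdjacentAt t.1 x ↔ x ∉ s.1.bSet ∧ ∀ y, y ∈ t.1.bSet ↔ y = x ∨ y ∈ s.1.bSet := by
  classical
  constructor
  · intro h
    refine ⟨notMem_bSet.2 h.label_left, fun y => ?_⟩
    rw [mem_bSet, mem_bSet]
    by_cases hy : y = x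
    · simp [hy, h.label_right]
    · simp [hy, h.label_eq y hy]
  · rintro ⟨hx, ht⟩
    have hcard : t.1.bSet = insert x s.1.bSet := by
      ext y
      rw [ht, Finset.mem_insert]
    refine ⟨?_, t.2.2.trans s.2.2.symm, notMem_bSet.1 hx, ?_, fun y hy => ?_, fun d _ => ?_,
      fun k => ?_⟩
    · rw [degI_eq_card_sub, degI_eq_card_sub, hcard, Finset.card_insert_of_notMem hx]
      push_cast
      ring
    · rw [← mem_bSet, ht]
      exact Or.inl rfl
    · have := ht y
      rw [mem_bSet, mem_bSet] at this
      cases h1 : t.1.label y <;> cases h2 : s.1.label y <;> simp_all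
    · rw [s.sgn, t.sgn]
    · rw [s.sgn, t.sgn]

theorem incidence_of_mem_iff (R : Type*) [CommRing R] (o : LinearOrder D.Crossing)
    (s : D.Generator i D.jMin) (t : D.Generator i' D.jMin) {x : D.Crossing}
    (hx : x ∉ s.1.bSet) (ht : ∀ y, y ∈ t.1.bSet ↔ y = x ∨ y ∈ s.1.bSet) :
    s.1.incidence R o t.1 = (-1) ^ (s.1.bSet.filter fun y => o.lt x y).card := by
  unfold incidence
  rw [Finset.sum_eq_single x]
  · rw [if_pos ((adjacentAt_iff s t x).2 ⟨hx, ht⟩)]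
    congr 2
    ext y
    simp [mem_bSet]
  · intro y _ hy
    rw [if_neg]
    rw [adjacentAt_iff]
    rintro ⟨h1, h2⟩
    exact ((ht y).1 ((h2 y).2 (Or.inl rfl))).elim hy h1
  · simp

theorem exists_of_incidence_ne_zero {R : Type*} [CommRing R] {o : LinearOrder D.Crossing}
    {s : D.Generator i D.jMin} {t : D.Generator i' D.jMin} (h : s.1.incidence R o t.1 ≠ 0) :
    ∃ x, x ∉ s.1.bSet ∧ ∀ y, y ∈ t.1.bSet ↔ y = x ∨ y ∈ s.1.bSet := by
  by_contra h'
  refine h (Finset.sum_eq_zero fun x _ => if_neg ?_)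
  rw [adjacentAt_iff]
  exact fun hx => h' ⟨x, hx⟩

/-- The order of the admissible chords that is induced by an order of the crossings. -/
abbrev chordOrder (oc : LinearOrder D.Crossing) : LinearOrder D.LandoVertex :=
  @LinearOrder.lift' _ _ oc Subtype.val Subtype.val_injective

/-- Both sides vanish unless `t` adds a single chord `v`. In that case `reorderSign` changes by the
product of the two incidence signs, and the one common to both factors squares to `1`. -/
theorem reorderSign_mul_coefficient (R : Type*) [CommRing R] (oc : LinearOrder D.Crossing)
    (ov : LinearOrder D.LandoVertex) (s : D.Generator i D.jMin) (t : D.Generator i' D.jMin) :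
    reorderSign R (chordOrder oc) ov (chords s.1.bSet) *
        coefficient R ov (chords s.1.bSet) (chords t.1.bSet) =
      s.1.incidence R oc t.1 * reorderSign R (chordOrder oc) ov (chords t.1.bSet) := by
  by_cases hex : ∃ v : D.LandoVertex, v.1 ∉ s.1.bSet ∧
      ∀ y, y ∈ t.1.bSet ↔ y = v.1 ∨ y ∈ s.1.bSet
  · obtain ⟨v, hv, ht⟩ := hex
    have hv' : v ∉ chords s.1.bSet := fun h => hv (mem_chords.1 h)
    have ht' : ∀ w, w ∈ chords t.1.bSet ↔ w = v ∨ w ∈ chords s.1.bSet := by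
      intro w
      rw [mem_chords, mem_chords, ht, Subtype.ext_iff]
    have hcard : (s.1.bSet.filter fun y => oc.lt v.1 y).card =
        (@Finset.filter _ (fun u => (chordOrder oc).lt v u) (fun _ => Classical.propDecidable _)
          (chords s.1.bSet)).card := by
      conv_lhs => rw [← map_chords s.isAdmissible]
      rw [Finset.filter_map, Finset.card_map]
      congr 1
      ext u
      simp only [Finset.mem_filter]
      rfl
    have hsq : ∀ k : ℕ, (-1 : R) ^ k * (-1) ^ k = 1 := fun k => by
      rw [← mul_pow]; simp
    rw [incidence_of_mem_iff R oc s t hv ht, coefficient_of_mem_iff R ov hv' ht',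
      reorderSign_of_mem_iff R (chordOrder oc) ov hv' ht', hcard, ← mul_assoc, ← mul_assoc, hsq,
      one_mul, mul_comm]
  · have h1 : coefficient R ov (chords s.1.bSet) (chords t.1.bSet) = 0 := by
      by_contra h
      obtain ⟨v, hv, hvt⟩ := exists_mem_iff_of_coefficient_ne_zero h
      refine hex ⟨v, fun h => hv (mem_chords.2 h), fun y => ⟨fun hy => ?_, ?_⟩⟩
      · exact ((hvt ⟨y, t.isAdmissible y hy⟩).1 (mem_chords.2 hy)).imp (congrArg Subtype.val)
          mem_chords.1
      · rintro (rfl | hy)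
        · exact mem_chords.1 ((hvt v).2 (Or.inl rfl))
        · exact mem_chords.1 ((hvt ⟨y, s.isAdmissible y hy⟩).2 (Or.inr (mem_chords.2 hy)))
    have h2 : s.1.incidence R oc t.1 = 0 := by
      by_contra h
      obtain ⟨x, hx, hxt⟩ := exists_of_incidence_ne_zero h
      exact hex ⟨⟨x, t.isAdmissible x ((hxt x).2 (Or.inl rfl))⟩, hx, hxt⟩
    rw [h1, h2, mul_zero, zero_mul]

theorem khovanovD_single_apply (R : Type*) [CommRing R] (o : LinearOrder D.Crossing) {j : ℤ}
    (s : D.Generator i j) (r : R) (t : D.Generator i' j) :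
    D.khovanovD R o j i i' (Finsupp.single s r) t = r * s.1.incidence R o t.1 := by
  classical
  rw [khovanovD, Finsupp.linearCombination_single, Finsupp.smul_apply, Finsupp.finsetSum_apply,
    Finset.sum_eq_single t]
  · rw [Finsupp.single_eq_same, smul_eq_mul]
  · intro t' _ h
    rw [Finsupp.single_eq_of_ne h.symm]
  · simp

/-- The isomorphism of the extreme Khovanov complex with the shifted Lando complex. -/
noncomputable def khovanovEquiv (R : Type*) [CommRing R] (oc : LinearOrder D.Crossing)
    (ov : LinearOrder D.LandoVertex) (h : m = i - 1 + D.numNeg) :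
    D.khovanovModule R i D.jMin ≃ₗ[R] cochain D.landoGraph R m :=
  Finsupp.signedEquiv (generatorEquiv h)
    (fun s => reorderSign R (chordOrder oc) ov (chords s.1.bSet))
    fun _ => reorderSign_mul_self R _ _ _

theorem coboundary_comp_khovanovEquiv (R : Type*) [CommRing R] (oc : LinearOrder D.Crossing)
    (ov : LinearOrder D.LandoVertex) (h : m = i - 1 + D.numNeg) (h' : m' = i' - 1 + D.numNeg) :
    coboundary D.landoGraph R ov m m' ∘ₗ (khovanovEquiv R oc ov h).toLinearMap =
      (khovanovEquiv R oc ov h').toLinearMap ∘ₗ D.khovanovD R oc D.jMin i i' := by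
  refine Finsupp.lhom_ext fun s r => Finsupp.ext fun ρ => ?_
  obtain ⟨t, rfl⟩ := (generatorEquiv h').surjective ρ
  rw [LinearMap.comp_apply, LinearMap.comp_apply, LinearEquiv.coe_coe, LinearEquiv.coe_coe,
    khovanovEquiv, khovanovEquiv, Finsupp.signedEquiv_apply, Finsupp.signedEquiv_single,
    coboundary_single_apply, khovanovD_single_apply, generatorEquiv_coe, generatorEquiv_coe,
    mul_assoc, mul_assoc, reorderSign_mul_coefficient]

/-- In the extreme degree the identity is transported from the coboundary through the isomorphisms,
with no analysis of merging and splitting circles. -/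
theorem khovanovD_comp_khovanovD (R : Type*) [CommRing R] (oc : LinearOrder D.Crossing)
    (i i' i'' : ℤ) :
    D.khovanovD R oc D.jMin i' i'' ∘ₗ D.khovanovD R oc D.jMin i i' = 0 := by
  let ov : LinearOrder D.LandoVertex := chordOrder oc
  have h1 := coboundary_comp_khovanovEquiv R oc ov (D := D) (i := i) (i' := i') rfl rfl
  have h2 := coboundary_comp_khovanovEquiv R oc ov (D := D) (i := i') (i' := i'') rfl rfl
  refine LinearMap.ext fun x => (khovanovEquiv R oc ov (i := i'') rfl).injective ?_
  have e1 := LinearMap.congr_fun h1 x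
  have e2 := LinearMap.congr_fun h2 (D.khovanovD R oc D.jMin i i' x)
  simp only [LinearMap.comp_apply, LinearEquiv.coe_coe] at e1 e2
  rw [LinearMap.comp_apply, ← e2, ← e1, LinearMap.zero_apply, map_zero]
  exact LinearMap.congr_fun (coboundary_comp_coboundary D.landoGraph R ov _ _ _) _

end LinkDiagram

theorem theorem4p3 (R : Type*) [CommRing R] (D : LinkDiagram)
    (oc : LinearOrder D.Crossing) (ov : LinearOrder D.LandoVertex) :
    (∀ i : ℤ, D.khovanovD R oc D.jMin (i + 1) (i + 2) ∘ₗ D.khovanovD R oc D.jMin i (i + 1) = 0) ∧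
    (∀ i : ℤ, IndependenceComplex.coboundary D.landoGraph R ov (i + 1) (i + 2) ∘ₗ
      IndependenceComplex.coboundary D.landoGraph R ov i (i + 1) = 0) ∧
    (∃ φ : ∀ i : ℤ, D.khovanovModule R i D.jMin ≃ₗ[R]
        IndependenceComplex.cochain D.landoGraph R (i - 1 + (D.numNeg : ℤ)),
      ∀ i : ℤ,
        IndependenceComplex.coboundary D.landoGraph R ov
            (i - 1 + (D.numNeg : ℤ)) (i + 1 - 1 + (D.numNeg : ℤ)) ∘ₗ (φ i).toLinearMap =
          (φ (i + 1)).toLinearMap ∘ₗ D.khovanovD R oc D.jMin i (i + 1)) ∧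
    (∀ i : ℤ, Nonempty (D.khovanovCohomology R oc i D.jMin ≃ₗ[R]
      IndependenceComplex.cohomology D.landoGraph R ov (i - 1 + (D.numNeg : ℤ)))) := by
  refine ⟨fun i => LinkDiagram.khovanovD_comp_khovanovD R oc _ _ _,
    fun i => IndependenceComplex.coboundary_comp_coboundary _ R ov _ _ _,
    ⟨fun i => LinkDiagram.khovanovEquiv R oc ov rfl, fun i =>
      LinkDiagram.coboundary_comp_khovanovEquiv R oc ov rfl rfl⟩, fun i => ?_⟩
  -- The outer degrees `i - 1 + n ± 1` equal `(i ± 1) - 1 + n` only by arithmetic; for this reason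
  -- `khovanovEquiv` takes its target degree with an equation.
  exact MiddleCohomology.nonempty_linearEquiv
    (LinkDiagram.khovanovEquiv R oc ov (by ring)) (LinkDiagram.khovanovEquiv R oc ov rfl)
    (LinkDiagram.khovanovEquiv R oc ov (by ring))
    (LinkDiagram.coboundary_comp_khovanovEquiv R oc ov _ _)
    (LinkDiagram.coboundary_comp_khovanovEquiv R oc ov _ _)
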